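/- **Setting.** Let $\mathcal S(\mathbb R)$ be the Schwartz space of real test functions, $C_0(\mathbb R)$ the space of continuous real functions vanishing at infinity, and $\mathcal M(\mathbb R)=C_0(\mathbb R)'$ with its dual norm $\|w\|_{\mathcal M}=\sup\{\langle w,\varphi\rangle:\varphi\in C_0(\mathbb R),\ \|\varphi\|_\infty=1\}$. Functions are real-valued, measurable, and identified when they agree almost everywhere. Let $\mathrm L$ be a linear shift-invariant operator, given by its formal adjoint $\mathrm L^*$, a linear map from $\mathcal S(\mathbb R)$ to measurable functions with $\mathrm L^*\{\varphi(\cdot-a)\}=(\mathrm L^*\varphi)(\cdot-a)$. It applies to the functions $f$ for which $\sup_{|a|\le R}\int_{\mathbb R}|f(x)\,\mathrm L^*\{\varphi(\cdot-a)\}(x)|\,dx<\infty$ for all $\varphi\in\mathcal S(\mathbb R)$ and $R>0$, and then $\langle \mathrm Lf,\varphi\rangle:=\int_{\mathbb R} f\,\mathrm L^*\varphi$. The search space is $$\mathcal X_1=\{f:\ \|\mathrm Lf\|_{\mathcal M}<\infty\},$$ i.e. the set of those $f$ for which there is a (necessarily unique) $\mathrm Lf\in\mathcal M(\mathbb R)$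 with $\int f\,\mathrm L^*\varphi=\langle \mathrm Lf,\varphi\rangle$ for all $\varphi\in\mathcal S(\mathbb R)$. Assume that $\mathrm L$ is spline-admissible: its null space $\mathcal N_{\mathrm L}=\{p\in\mathcal X_1:\mathrm Lp=0\}$ is finite-dimensional, with basis $p_1,\dots,p_{N_0}$, and it has a Green's function $\rho_{\mathrm L}\in\mathcal X_1$, $\mathrm L\rho_{\mathrm L}=\delta$. Let $\phi_1,\dots,\phi_{N_0}$ be linear functionals on $\mathcal X_1$ with $\langle\phi_m,p_n\rangle=1$ if $m=n$ and $0$ otherwise. The weak*-topology of $\mathcal X_1$ (with respect to $\mathrm L^*(C_0(\mathbb R))\oplus\operatorname{span}\{\phi_n\}$) is the coarsest topology for which $f\mapsto\langle \mathrm Lf,\psi\rangle$, $\psi\in C_0(\mathbb R)$, and $f\mapsto\langle\phi_n,f\rangle$, $n=1,\dots,N_0$, are continuous. Let $\mathrm H:\mathcal X_1\to\mathbb R^M$ be linear and weak*-continuous, with $\mathrm H\{q_1\}=\mathrm H\{q_2\}\Leftrightarrow q_1=q_2$ for all $q_1,q_2\in\mathcal N_{\mathrm L}$. Let $E:\mathbb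 R^M\times\mathbb R^M\to[0,\infty]$ and $\mathbf z\in\mathbb R^M$ be such that $E(\mathbf z,\cdot)$ is convex, lower semi-continuous and coercive ($E(\mathbf z,\mathbf y)\to\infty$ as $\|\mathbf y\|\to\infty$), and $E(\mathbf z,\mathrm H\{f\})<\infty$ for at least one $f\in\mathcal X_1$. Let $\lambda>0$. **Theorem.** The set $$\mathcal V=\arg\min_{f\in\mathcal X_1}\bigl(E(\mathbf z,\mathrm H\{f\})+\lambda\|\mathrm Lf\|_{\mathcal M}\bigr)$$ of minimizers is nonempty, convex and weak*-compact, and it is the weak*-closed convex hull of its extreme points. Every extreme point $f$ of $\mathcal V$ is a nonuniform $\mathrm L$-spline: there are $K\le M-N_0$, distinct knots $x_1,\dots,x_K\in\mathbb R$, and coefficients $\mathbf a\in\mathbb R^K$, $\mathbf b\in\mathbb R^{N_0}$ such that $$\mathrm Lf=\sum_{k=1}^K a_k\,\delta(\cdot-x_k),\qquad f=\sum_{k=1}^K a_k\,\rho_{\mathrm L}(\cdot-x_k)+\sum_{n=1}^{N_0}b_n\,p_n,\qquad \|\mathrm Lf\|_{\mathcal M}=\|\mathbf a\|_1 .$$ 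-/

import Mathlib

open MeasureTheory Set Filter Topology
open scoped SchwartzMap ZeroAtInfty ENNReal NNReal

noncomputable section

namespace GTV

/-- Real-valued measurable functions on the line, up to equality almost everywhere. -/
abbrev Fn : Type := ℝ →ₘ[volume] ℝ

/-- The space `𝓜(ℝ)`, as the topological dual of `C₀(ℝ)`. Its norm is the dual norm
`‖w‖ = sup {⟨w, φ⟩ : φ ∈ C₀(ℝ), ‖φ‖_∞ = 1}`, that is, the total variation. -/
abbrev Meas : Type := StrongDual ℝ C₀(ℝ, ℝ)

/-- The Dirac mass `δ(· - x)`. -/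
def dirac (x : ℝ) : Meas :=
  LinearMap.mkContinuous
    { toFun := fun φ : C₀(ℝ, ℝ) => φ x
      map_add' := fun _ _ => rfl
      map_smul' := fun _ _ => rfl } 1 (fun φ => by
        rw [one_mul, ← ZeroAtInftyContinuousMap.norm_toBCF_eq_norm]
        exact φ.toBCF.norm_coe_le_norm x)

/-- The shifted function `f(· - a)`. -/
def shift (a : ℝ) (f : Fn) : Fn :=
  f.compMeasurePreserving (fun x => x - a) (measurePreserving_sub_right volume a)

/-- The shifted test function `φ(· - a)`. -/
def shiftTest (a : ℝ) (φ : 𝓢(ℝ, ℝ)) : 𝓢(ℝ, ℝ) := φ.compSubConstCLM ℝ a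

theorem shiftTest_zero (φ : 𝓢(ℝ, ℝ)) : shiftTest 0 φ = φ := by
  simp [shiftTest]

/-- A linear shift-invariant operator `L` on generalized functions. It is given by its formal
adjoint `L*` on test functions, a linear map that sends test functions to functions and commutes
with shifts; `L f` is the functional `φ ↦ ⟨f, L* φ⟩`. -/
structure LSIOperator where
  adj : 𝓢(ℝ, ℝ) →ₗ[ℝ] Fn
  adj_shift : ∀ (a : ℝ) (φ : 𝓢(ℝ, ℝ)), adj (shiftTest a φ) = shift a (adj φ)

namespace LSIOperator

variable (L : LSIOperator)

/-- The functions `f` to which `L` applies: all integrals `⟨f, L*{φ(· - a)}⟩` converge absolutely,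
locally uniformly in the shift `a`. -/
def Applies (f : Fn) : Prop :=
  ∀ (φ : 𝓢(ℝ, ℝ)) (R : ℝ), ∃ C : ℝ≥0, ∀ a ∈ Icc (-R) R,
    ∫⁻ x, ‖f x * L.adj (shiftTest a φ) x‖ₑ ≤ C

/-- `L f = w` in the sense of generalized functions: `⟨f, L* φ⟩ = ⟨w, φ⟩` for all test functions. -/
def Maps (f : Fn) (w : Meas) : Prop :=
  ∀ φ : 𝓢(ℝ, ℝ), ∫ x, f x * L.adj φ x = w φ.toZeroAtInfty

theorem Applies.integrable {L : LSIOperator} {f : Fn} (hf : L.Applies f) (φ : 𝓢(ℝ, ℝ)) :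
    Integrable (fun x => f x * L.adj φ x) := by
  refine ⟨f.aestronglyMeasurable.mul (L.adj φ).aestronglyMeasurable, ?_⟩
  obtain ⟨C, hC⟩ := hf φ 0
  have h := hC 0 (by simp)
  rw [shiftTest_zero] at h
  exact lt_of_le_of_lt h ENNReal.coe_lt_top

theorem Applies.add {L : LSIOperator} {f g : Fn} (hf : L.Applies f) (hg : L.Applies g) :
    L.Applies (f + g) := by
  intro φ R
  obtain ⟨C, hC⟩ := hf φ R
  obtain ⟨D, hD⟩ := hg φ R
  refine ⟨C + D, fun a ha => ?_⟩
  calc ∫⁻ x, ‖(f + g) x * L.adj (shiftTest a φ) x‖ₑ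
      ≤ ∫⁻ x, (‖f x * L.adj (shiftTest a φ) x‖ₑ + ‖g x * L.adj (shiftTest a φ) x‖ₑ) := by
        refine lintegral_mono_ae ?_
        filter_upwards [AEEqFun.coeFn_add f g] with x hx
        rw [hx, Pi.add_apply, add_mul]
        exact enorm_add_le _ _
    _ = (∫⁻ x, ‖f x * L.adj (shiftTest a φ) x‖ₑ) + ∫⁻ x, ‖g x * L.adj (shiftTest a φ) x‖ₑ :=
        lintegral_add_left' (f.aestronglyMeasurable.mul
          (L.adj (shiftTest a φ)).aestronglyMeasurable).enorm _
    _ ≤ ((C + D : ℝ≥0) : ℝ≥0∞) := by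
        rw [ENNReal.coe_add]
        exact add_le_add (hC a ha) (hD a ha)

theorem Applies.smul {L : LSIOperator} {f : Fn} (c : ℝ) (hf : L.Applies f) :
    L.Applies (c • f) := by
  intro φ R
  obtain ⟨C, hC⟩ := hf φ R
  refine ⟨‖c‖₊ * C, fun a ha => ?_⟩
  calc ∫⁻ x, ‖(c • f) x * L.adj (shiftTest a φ) x‖ₑ
      = ∫⁻ x, ‖c‖ₑ * ‖f x * L.adj (shiftTest a φ) x‖ₑ := by
        refine lintegral_congr_ae ?_
        filter_upwards [AEEqFun.coeFn_smul c f] with x hx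
        rw [hx, Pi.smul_apply, smul_eq_mul, mul_assoc, enorm_mul]
    _ = ‖c‖ₑ * ∫⁻ x, ‖f x * L.adj (shiftTest a φ) x‖ₑ :=
        lintegral_const_mul' _ _ enorm_ne_top
    _ ≤ ((‖c‖₊ * C : ℝ≥0) : ℝ≥0∞) := by
        rw [ENNReal.coe_mul]
        exact mul_le_mul' le_rfl (hC a ha)

theorem Maps.add {L : LSIOperator} {f g : Fn} {v w : Meas} (hf : L.Applies f) (hg : L.Applies g)
    (hv : L.Maps f v) (hw : L.Maps g w) : L.Maps (f + g) (v + w) := by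
  intro φ
  rw [_root_.add_apply, ← hv φ, ← hw φ,
    ← integral_add (hf.integrable φ) (hg.integrable φ)]
  refine integral_congr_ae ?_
  filter_upwards [AEEqFun.coeFn_add f g] with x hx
  rw [hx, Pi.add_apply, add_mul]

theorem Maps.smul {L : LSIOperator} {f : Fn} {v : Meas} (c : ℝ) (hv : L.Maps f v) :
    L.Maps (c • f) (c • v) := by
  intro φ
  rw [_root_.smul_apply, ← hv φ, smul_eq_mul, ← integral_const_mul]
  refine integral_congr_ae ?_
  filter_upwards [AEEqFun.coeFn_smul c f] with x hx
  rw [hx, Pi.smul_apply, smul_eq_mul, mul_assoc]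

/-- The search space `𝓧₁ = {f : ‖L f‖_𝓜 < ∞}`: the functions to which `L` applies and whose image
under `L` is an element of `𝓜(ℝ)`. -/
def searchSpace : Submodule ℝ Fn where
  carrier := {f | L.Applies f ∧ ∃ w : Meas, L.Maps f w}
  zero_mem' := by
    have h0 : L.Applies 0 := by
      intro φ R
      refine ⟨0, fun a _ => ?_⟩
      refine le_of_eq ?_
      rw [ENNReal.coe_zero]
      refine (lintegral_congr_ae ?_).trans lintegral_zero
      filter_upwards [AEEqFun.coeFn_zero (α := ℝ) (β := ℝ) (μ := volume)] with x hx
      rw [hx]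
      simp
    refine ⟨h0, 0, fun φ => ?_⟩
    rw [_root_.zero_apply]
    refine (integral_congr_ae ?_).trans (integral_zero ℝ ℝ)
    filter_upwards [AEEqFun.coeFn_zero (α := ℝ) (β := ℝ) (μ := volume)] with x hx
    rw [hx]
    simp
  add_mem' := by
    rintro f g ⟨hf, v, hv⟩ ⟨hg, w, hw⟩
    exact ⟨hf.add hg, v + w, hv.add hf hg hw⟩
  smul_mem' := by
    rintro c f ⟨hf, v, hv⟩
    exact ⟨hf.smul c, c • v, hv.smul c⟩

end LSIOperator

/-- Test functions are dense in `C₀(ℝ)`. -/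
theorem denseRange_toZeroAtInfty :
    DenseRange (fun φ : 𝓢(ℝ, ℝ) => (φ.toZeroAtInfty : C₀(ℝ, ℝ))) := by
  intro g
  rw [Metric.mem_closure_range_iff]
  intro ε hε
  have hg : ∀ᶠ x in cocompact ℝ, |g x| < ε / 4 := by
    have h := g.zero_at_infty'.eventually (Metric.ball_mem_nhds (0 : ℝ) (by positivity : 0 < ε / 4))
    filter_upwards [h] with x hx
    simpa [Real.dist_eq] using hx
  obtain ⟨R, hR⟩ : ∃ R : ℝ, ∀ x : ℝ, R < |x| → |g x| < ε / 4 := by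
    rw [← Metric.cobounded_eq_cocompact] at hg
    obtain ⟨R, -, hR⟩ :=
      (Metric.hasBasis_cobounded_compl_closedBall (0 : ℝ)).eventually_iff.mp hg
    refine ⟨R, fun x hx => hR ?_⟩
    simpa [Real.dist_eq] using hx
  let χ : ContDiffBump (0 : ℝ) := ⟨max R 1, max R 1 + 1, by positivity, by linarith⟩
  have hc : Continuous (fun x => χ x * g x) := χ.continuous.mul g.continuous
  obtain ⟨h, h1, h2, h3⟩ := hc.exists_contDiff_approx (⊤ : ℕ∞) (ε := fun _ => ε / 4)
    continuous_const (fun _ => by positivity)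
  have hs : HasCompactSupport h := by
    refine χ.hasCompactSupport.mono (h3.trans ?_)
    intro x hx
    exact left_ne_zero_of_mul hx
  refine ⟨hs.toSchwartzMap h1, ?_⟩
  refine lt_of_le_of_lt (?_ : _ ≤ ε / 2) (by linarith)
  rw [← ZeroAtInftyContinuousMap.dist_toBCF_eq_dist,
    BoundedContinuousFunction.dist_le (by positivity)]
  intro x
  have e1 : dist (g x) (χ x * g x) ≤ ε / 4 := by
    rw [Real.dist_eq]
    by_cases hx : |x| ≤ max R 1
    · rw [χ.one_of_mem_closedBall (by simpa [χ, Real.dist_eq] using hx)]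
      simp
      positivity
    · have hx' := hR x (lt_of_le_of_lt (le_max_left _ _) (not_le.mp hx))
      have e : g x - χ x * g x = (1 - χ x) * g x := by ring
      rw [e, abs_mul, abs_of_nonneg (by linarith [χ.le_one (x := x)])]
      have := χ.nonneg (x := x)
      nlinarith [abs_nonneg (g x), χ.le_one (x := x)]
  have e2 := h2 x
  have e3 : dist (g x) (h x) ≤ ε / 2 := by
    have := dist_triangle_right (g x) (h x) (χ x * g x)
    linarith
  exact e3

theorem LSIOperator.Maps.unique {L : LSIOperator} {f : Fn} {v w : Meas}
    (hv : L.Maps f v) (hw : L.Maps f w) : v = w := by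
  have h : (v : C₀(ℝ, ℝ) → ℝ) = w := by
    refine denseRange_toZeroAtInfty.equalizer v.continuous w.continuous ?_
    funext φ
    exact (hv φ).symm.trans (hw φ)
  exact DFunLike.coe_injective h

namespace LSIOperator

variable (L : LSIOperator)

/-- The operator `L : 𝓧₁ → 𝓜(ℝ)`. -/
def op : L.searchSpace →ₗ[ℝ] Meas where
  toFun f := f.2.2.choose
  map_add' f g := (f + g).2.2.choose_spec.unique
    (f.2.2.choose_spec.add f.2.1 g.2.1 g.2.2.choose_spec)
  map_smul' c f := (c • f).2.2.choose_spec.unique (f.2.2.choose_spec.smul c)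

/-- The null space `𝓝_L = {p ∈ 𝓧₁ : L p = 0}`. -/
abbrev nullSpace : Submodule ℝ L.searchSpace := LinearMap.ker L.op

/-- `ρ` is a Green's function of `L`: it belongs to `𝓧₁` and `L ρ = δ`. -/
def IsGreen (ρ : Fn) : Prop :=
  ∃ h : ρ ∈ L.searchSpace, L.op ⟨ρ, h⟩ = dirac 0

/-- Spline-admissibility of a linear shift-invariant operator. -/
structure SplineAdmissible : Prop where
  finite_nullSpace : FiniteDimensional ℝ L.nullSpace
  exists_green : ∃ ρ : Fn, L.IsGreen ρ

/-- `f` is a nonuniform `L`-spline with knots `x₁, …, x_K` and weights `a₁, …, a_K`. -/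
def IsSpline (f : L.searchSpace) {K : ℕ} (x a : Fin K → ℝ) : Prop :=
  Function.Injective x ∧ L.op f = ∑ k, a k • dirac (x k)

/-- The linear functionals `φ₁, …, φ_{N₀}` on `𝓧₁` are biorthonormal to the basis `p` of the
null space. Such a system gives the projector `P f = ∑ ⟨φ_n, f⟩ p_n` of `𝓧₁` onto `𝓝_L` and the norm
`‖L f‖_𝓜 + ‖(⟨φ_n, f⟩)_n‖₂` of `𝓧₁`. -/
def Biorthonormal {N₀ : ℕ} (p : Module.Basis (Fin N₀) ℝ L.nullSpace)
    (φ : Fin N₀ → L.searchSpace →ₗ[ℝ] ℝ) : Prop :=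
  ∀ m n, φ m (p n) = if m = n then 1 else 0

/-- The weak* topology of `𝓧₁`, as the dual of the space `L*(C₀(ℝ)) ⊕ span {φ_n}`: the coarsest
topology for which all `f ↦ ⟨f, L*ψ⟩ = ⟨L f, ψ⟩` with `ψ ∈ C₀(ℝ)` and all `f ↦ ⟨φ_n, f⟩` are
continuous. -/
@[reducible]
def weakStar {N₀ : ℕ} (φ : Fin N₀ → L.searchSpace →ₗ[ℝ] ℝ) : TopologicalSpace L.searchSpace :=
  TopologicalSpace.induced
    (fun f => ((fun ψ => L.op f ψ, fun n => φ n f) : (C₀(ℝ, ℝ) → ℝ) × (Fin N₀ → ℝ)))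
    inferInstance

/-- The cost `E(z, H f) + lam ‖L f‖_𝓜`. -/
def cost {M : ℕ} (E : (Fin M → ℝ) → (Fin M → ℝ) → ℝ≥0∞) (z : Fin M → ℝ) (lam : ℝ)
    (H : L.searchSpace →ₗ[ℝ] (Fin M → ℝ)) (f : L.searchSpace) : ℝ≥0∞ :=
  E z (H f) + ENNReal.ofReal (lam * ‖L.op f‖)

/-- The set `𝓥` of minimizers of the cost over `𝓧₁`. -/
def minimizers {M : ℕ} (E : (Fin M → ℝ) → (Fin M → ℝ) → ℝ≥0∞) (z : Fin M → ℝ) (lam : ℝ)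
    (H : L.searchSpace →ₗ[ℝ] (Fin M → ℝ)) : Set L.searchSpace :=
  {f | ∀ g, L.cost E z lam H f ≤ L.cost E z lam H g}

end LSIOperator

end GTV

end

/-! The map `f ↦ (L f, (⟨φ_n, f⟩)_n)` embeds `𝓧₁` into `𝓜(ℝ) × ℝ^{N₀}` and induces its weak*
topology. The image need not be everything: convolution with the Green's function inverts `L` only
on compactly supported measures. The problem is therefore relaxed to the whole product, where
Banach–Alaoglu, coercivity and injectivity of `H` on the null space give a nonempty weak*-compact
set of minimizers.

Relaxed minimizers turn out to lie in the image. The measurements see a measure `w` only through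
finitely many `ψ_i ∈ C₀(ℝ)`, so Hahn–Banach on a finite-dimensional subspace shows that an optimal
`w` attains its norm at some `η` in the unit ball of `C₀(ℝ)` (`exists_certificate`). Then `w = η μ`
with `μ ≥ 0` carried by `{|η| = 1}`, which is compact because `η` vanishes at infinity
(`exists_measure_of_norm_attained`), and `ρ * (η μ)` is a preimage under `L` (`IsGreen.maps_conv`).
So the two problems have the same minimizers, and Krein–Milman applies.

At an extreme minimizer, perturb `η μ` to `η (1 + s τ) μ`. For small `s` of either sign the norm is
at most `‖w‖ + s ∫ τ dμ`, so a perturbation invisible to `H` would produce a segment of minimizers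
around `f`. With `K` points in the support of `μ`, interpolating `τ`'s and the null space give `K +
N₀` independent directions on which `H` must be injective; hence `K + N₀ ≤ M` (`card_support_le`).
-/

noncomputable section

namespace GTV

/-! ### The relaxed problem on a dual space times `ℝ^N` -/

section DualProblem

variable {V : Type*} [NormedAddCommGroup V] [NormedSpace ℝ V] {M N : ℕ}

/-- The cost `E(A (w, c)) + lam ‖w‖` on the product of a dual space with `ℝ^N`. -/
def dualCost (E : (Fin M → ℝ) → ℝ≥0∞) (lam : ℝ)
    (A : WeakDual ℝ V × (Fin N → ℝ) →L[ℝ] (Fin M → ℝ)) (y : WeakDual ℝ V × (Fin N → ℝ)) : ℝ≥0∞ :=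
  E (A y) + ENNReal.ofReal (lam * ‖WeakDual.toStrongDual y.1‖)

/-- The minimizers of `dualCost`. -/
def dualMinimizers (E : (Fin M → ℝ) → ℝ≥0∞) (lam : ℝ)
    (A : WeakDual ℝ V × (Fin N → ℝ) →L[ℝ] (Fin M → ℝ)) : Set (WeakDual ℝ V × (Fin N → ℝ)) :=
  {y | ∀ y', dualCost E lam A y ≤ dualCost E lam A y'}

variable {E : (Fin M → ℝ) → ℝ≥0∞} {lam : ℝ}
  {A : WeakDual ℝ V × (Fin N → ℝ) →L[ℝ] (Fin M → ℝ)}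

theorem ofReal_mul_norm_le_iff (hlam : 0 < lam) {r : ℝ≥0∞} (hr : r ≠ ⊤) (w : StrongDual ℝ V) :
    ENNReal.ofReal (lam * ‖w‖) ≤ r ↔ ‖w‖ ≤ r.toReal / lam := by
  rw [ENNReal.ofReal_le_iff_le_toReal hr, le_div_iff₀ hlam, mul_comm]

/-- Sublevel sets of the dual norm are balls, and these are weak*-closed. -/
theorem lowerSemicontinuous_dualCost (hlam : 0 < lam) (hE : LowerSemicontinuous E) :
    LowerSemicontinuous (dualCost E lam A) := by
  refine (hE.comp A.continuous).add ?_
  rw [lowerSemicontinuous_iff_isClosed_preimage]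
  intro r
  by_cases hr : r = ⊤
  · simp [hr]
  · have h : (fun y : WeakDual ℝ V × (Fin N → ℝ) =>
        ENNReal.ofReal (lam * ‖WeakDual.toStrongDual y.1‖)) ⁻¹' Iic r =
        Prod.fst ⁻¹' (WeakDual.toStrongDual ⁻¹' Metric.closedBall 0 (r.toReal / lam)) := by
      ext y
      simp only [mem_preimage, mem_Iic, Metric.mem_closedBall, dist_zero_right]
      exact ofReal_mul_norm_le_iff hlam hr _
    rw [h]
    exact (WeakDual.isClosed_closedBall _ _).preimage continuous_fst

-- The norm term confines `w` to a dual ball `B`, compact by Banach–Alaoglu, and coercivity confines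
-- `A y` to a compact `K`. Hence `A (0, c) = A y - A (w, 0)` lies in the compact set `K - A₁ '' B`,
-- and injectivity in `c` makes its preimage compact.
open scoped Pointwise in
theorem isCompact_dualCost_le (hlam : 0 < lam) (hE : LowerSemicontinuous E)
    (hcoer : Tendsto E (cocompact (Fin M → ℝ)) (𝓝 ⊤))
    (hA : ∀ c, A (0, c) = 0 → c = 0) {r : ℝ≥0∞} (hr : r ≠ ⊤) :
    IsCompact {y | dualCost E lam A y ≤ r} := by
  obtain ⟨K, hK, hKE⟩ : ∃ K : Set (Fin M → ℝ), IsCompact K ∧ ∀ v, E v ≤ r → v ∈ K := by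
    have h := hcoer.eventually (lt_mem_nhds (lt_top_iff_ne_top.mpr hr))
    obtain ⟨K, hK, hKE⟩ := mem_cocompact.mp h
    exact ⟨K, hK, fun v hv => by_contra fun hvK => not_lt.mpr hv (hKE hvK)⟩
  let B : Set (WeakDual ℝ V) := WeakDual.toStrongDual ⁻¹' Metric.closedBall 0 (r.toReal / lam)
  have hB : IsCompact B := WeakDual.isCompact_closedBall _ _
  let A₁ : WeakDual ℝ V →L[ℝ] (Fin M → ℝ) := A.comp (ContinuousLinearMap.inl ℝ _ _)
  let A₂ : (Fin N → ℝ) →L[ℝ] (Fin M → ℝ) := A.comp (ContinuousLinearMap.inr ℝ _ _)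
  have hA₂ : IsClosedEmbedding A₂ := LinearMap.isClosedEmbedding_of_injective
    (f := A₂.toLinearMap) (LinearMap.ker_eq_bot'.mpr hA)
  have hD : IsCompact (A₂ ⁻¹' (K - A₁ '' B)) :=
    hA₂.isCompact_preimage (by rw [sub_eq_add_neg]; exact hK.add (hB.image A₁.continuous).neg)
  refine (hB.prod hD).of_isClosed_subset
    ((lowerSemicontinuous_dualCost hlam hE).isClosed_preimage r) ?_
  intro y hy
  have hyr : dualCost E lam A y ≤ r := hy
  have h1 : y.1 ∈ B := by
    simp only [B, mem_preimage, Metric.mem_closedBall, dist_zero_right]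
    exact (ofReal_mul_norm_le_iff hlam hr _).mp (le_add_self.trans hyr)
  refine ⟨h1, ?_⟩
  refine ⟨A y, hKE _ (le_self_add.trans hyr), A₁ y.1, mem_image_of_mem _ h1, ?_⟩
  have : y = (y.1, 0) + (0, y.2) := by simp
  rw [sub_eq_iff_eq_add]
  conv_lhs => rw [this, map_add, add_comm]
  rfl

theorem dualMinimizers_nonempty (hlam : 0 < lam) (hE : LowerSemicontinuous E)
    (hcoer : Tendsto E (cocompact (Fin M → ℝ)) (𝓝 ⊤))
    (hA : ∀ c, A (0, c) = 0 → c = 0) (hfeas : ∃ y, E (A y) ≠ ⊤) :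
    (dualMinimizers E lam A).Nonempty := by
  obtain ⟨y₀, h₀⟩ := hfeas
  have hr : dualCost E lam A y₀ ≠ ⊤ := ENNReal.add_ne_top.mpr ⟨h₀, ENNReal.ofReal_ne_top⟩
  obtain ⟨y, -, hmin⟩ := LowerSemicontinuousOn.exists_isMinOn (f := dualCost E lam A)
    (s := {y | dualCost E lam A y ≤ dualCost E lam A y₀}) ⟨y₀, le_refl (dualCost E lam A y₀)⟩
    (isCompact_dualCost_le hlam hE hcoer hA hr)
    ((lowerSemicontinuous_dualCost hlam hE).lowerSemicontinuousOn _)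
  refine ⟨y, fun y' => ?_⟩
  rcases le_total (dualCost E lam A y') (dualCost E lam A y₀) with h | h
  · exact hmin h
  · exact (hmin (le_refl (dualCost E lam A y₀))).trans h

theorem dualCost_ne_top_of_mem_dualMinimizers (hfeas : ∃ y, E (A y) ≠ ⊤)
    {y : WeakDual ℝ V × (Fin N → ℝ)} (hy : y ∈ dualMinimizers E lam A) :
    dualCost E lam A y ≠ ⊤ := by
  obtain ⟨y₀, h₀⟩ := hfeas
  exact ne_top_of_le_ne_top (ENNReal.add_ne_top.mpr ⟨h₀, ENNReal.ofReal_ne_top⟩) (hy y₀)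

theorem isCompact_dualMinimizers (hlam : 0 < lam) (hE : LowerSemicontinuous E)
    (hcoer : Tendsto E (cocompact (Fin M → ℝ)) (𝓝 ⊤))
    (hA : ∀ c, A (0, c) = 0 → c = 0) (hfeas : ∃ y, E (A y) ≠ ⊤) :
    IsCompact (dualMinimizers E lam A) := by
  obtain ⟨y, hy⟩ := dualMinimizers_nonempty hlam hE hcoer hA hfeas
  have h : dualMinimizers E lam A = {y' | dualCost E lam A y' ≤ dualCost E lam A y} :=
    Set.ext fun y' => ⟨fun h => h y, fun h y'' => le_trans h (hy y'')⟩
  rw [h]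
  exact isCompact_dualCost_le hlam hE hcoer hA (dualCost_ne_top_of_mem_dualMinimizers hfeas hy)

theorem norm_le_of_mem_dualMinimizers (hlam : 0 < lam) (hfeas : ∃ y, E (A y) ≠ ⊤)
    {y y' : WeakDual ℝ V × (Fin N → ℝ)} (hy : y ∈ dualMinimizers E lam A) (h : A y' = A y) :
    ‖WeakDual.toStrongDual y.1‖ ≤ ‖WeakDual.toStrongDual y'.1‖ := by
  have h1 := hy y'
  have h2 := (ENNReal.add_ne_top.mp (dualCost_ne_top_of_mem_dualMinimizers hfeas hy)).1
  simp only [dualCost, h] at h1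
  rw [ENNReal.add_le_add_iff_left h2, ENNReal.ofReal_le_ofReal_iff (by positivity)] at h1
  exact le_of_mul_le_mul_left h1 hlam

/-- A functional on a finite-dimensional space attains its norm. -/
theorem exists_norm_le_one_apply_eq_norm {W : Type*} [NormedAddCommGroup W] [NormedSpace ℝ W]
    [FiniteDimensional ℝ W] (g : StrongDual ℝ W) : ∃ η : W, ‖η‖ ≤ 1 ∧ g η = ‖g‖ := by
  have : ProperSpace W := FiniteDimensional.proper ℝ W
  obtain ⟨η, hη, hmax⟩ := (isCompact_closedBall (0 : W) 1).exists_isMaxOn ⟨0, by simp⟩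
    g.continuous.continuousOn
  have hη1 : ‖η‖ ≤ 1 := by simpa using hη
  refine ⟨η, hη1, le_antisymm ((le_abs_self _).trans (g.unit_le_opNorm η hη1)) ?_⟩
  have h0 : 0 ≤ g η := by
    simpa using hmax (show (0 : W) ∈ Metric.closedBall 0 1 by simp)
  refine g.opNorm_le_of_unit_norm h0 fun x hx => ?_
  rw [Real.norm_eq_abs, abs_le']
  refine ⟨hmax (by simp [hx]), ?_⟩
  rw [← map_neg]
  exact hmax (by simp [hx])

/-- The first component of a minimizer attains its norm on the predual. -/
theorem exists_certificate (hlam : 0 < lam) (hfeas : ∃ y, E (A y) ≠ ⊤) (ψ : Fin M → V)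
    (hψ : ∀ w i, A (w, 0) i = w (ψ i)) {y : WeakDual ℝ V × (Fin N → ℝ)}
    (hy : y ∈ dualMinimizers E lam A) :
    ∃ η : V, ‖η‖ ≤ 1 ∧ y.1 η = ‖WeakDual.toStrongDual y.1‖ := by
  let A₂ : (Fin N → ℝ) →ₗ[ℝ] (Fin M → ℝ) := (A.comp (ContinuousLinearMap.inr ℝ _ _)).toLinearMap
  -- The pre-adjoint of `w ↦ A (w, 0)`.
  let Ψ : Module.Dual ℝ (Fin M → ℝ) →ₗ[ℝ] V :=
    ∑ i, (LinearMap.applyₗ (Pi.single i 1 : Fin M → ℝ)).smulRight (ψ i)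
  have hΨ : ∀ (u : Module.Dual ℝ (Fin M → ℝ)) (w : WeakDual ℝ V), w (Ψ u) = u (A (w, 0)) := by
    intro u w
    simp only [Ψ, LinearMap.sum_apply, LinearMap.smulRight_apply, LinearMap.applyₗ_apply_apply,
      map_sum, map_smul, smul_eq_mul]
    conv_rhs => rw [LinearMap.pi_apply_eq_sum_univ u]
    refine Finset.sum_congr rfl fun i _ => ?_
    rw [hψ, smul_eq_mul, mul_comm]
    congr 2
    ext j
    simp [Pi.single_apply, eq_comm]
  -- Two functionals that agree on `W` have measurements differing by an element of `range A₂`,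
  -- which a change of `c` compensates.
  let W : Submodule ℝ V := (LinearMap.range A₂).dualAnnihilator.map Ψ
  have : FiniteDimensional ℝ W := inferInstance
  let w₀ : StrongDual ℝ V := WeakDual.toStrongDual y.1
  -- Minimality compares `w₀` with the norm-preserving extension `w` of its restriction to `W`, so
  -- `‖w₀‖` equals the norm of that restriction. The latter is attained since `W` is
  -- finite-dimensional.
  obtain ⟨w, hw, hnorm⟩ := exists_extension_norm_eq W (w₀.comp W.subtypeL)
  obtain ⟨η, hη, hη'⟩ := exists_norm_le_one_apply_eq_norm (w₀.comp W.subtypeL)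
  refine ⟨η, hη, ?_⟩
  have key : A (StrongDual.toWeakDual w - y.1, 0) ∈ LinearMap.range A₂ := by
    rw [← Subspace.forall_mem_dualAnnihilator_apply_eq_zero_iff]
    intro u hu
    rw [← hΨ]
    have := hw ⟨Ψ u, Submodule.mem_map_of_mem hu⟩
    exact sub_eq_zero.mpr this
  obtain ⟨c, hc⟩ := key
  have hle : ‖w₀‖ ≤ ‖w‖ := by
    refine norm_le_of_mem_dualMinimizers (y' := (StrongDual.toWeakDual w, y.2 - c)) hlam hfeas hy ?_
    have hc' : A (0, c) = A (StrongDual.toWeakDual w - y.1, 0) := hc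
    have e : ((StrongDual.toWeakDual w, y.2 - c) : WeakDual ℝ V × (Fin N → ℝ)) =
        y + (StrongDual.toWeakDual w - y.1, 0) - (0, c) := by
      ext1 <;> simp
    rw [e, map_sub, map_add, hc', add_sub_cancel_right]
  have h1 : w₀ η ≤ ‖w₀‖ := (le_abs_self _).trans (w₀.unit_le_opNorm _ hη)
  have h2 : w₀ η = ‖w‖ := by rw [hnorm]; exact hη'
  exact le_antisymm h1 (hle.trans h2.ge)

end DualProblem

/-! ### Polar decomposition of norm-attaining functionals -/

section NormAttaining

open scoped CompactlySupported

theorem abs_apply_le_norm (g : C₀(ℝ, ℝ)) (x : ℝ) : |g x| ≤ ‖g‖ := by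
  rw [← ZeroAtInftyContinuousMap.norm_toBCF_eq_norm]
  exact g.toBCF.norm_coe_le_norm x

theorem norm_le_of_forall_abs_le {g : C₀(ℝ, ℝ)} {C : ℝ} (hC : 0 ≤ C) (h : ∀ x, |g x| ≤ C) :
    ‖g‖ ≤ C := by
  rw [← ZeroAtInftyContinuousMap.norm_toBCF_eq_norm]
  exact (BoundedContinuousFunction.norm_le hC).mpr h

variable {w : Meas} {η : C₀(ℝ, ℝ)}

/-- If `w` attains its norm at `η` then perturbations that stay in the unit ball do not increase
`w`. -/
theorem apply_le_zero_of_norm_add_le_one (hw : w η = ‖w‖) {g : C₀(ℝ, ℝ)}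
    (h : ∀ x, |η x + g x| ≤ 1) : w g ≤ 0 := by
  have h1 : ‖η + g‖ ≤ 1 := norm_le_of_forall_abs_le zero_le_one h
  have h2 : w (η + g) ≤ ‖w‖ := (le_abs_self _).trans (w.unit_le_opNorm _ h1)
  rw [map_add, hw] at h2
  linarith

/-- The function `η (1 - ε g)` stays in the unit ball for `ε = (‖g‖ + 1)⁻¹`. -/
theorem apply_mul_nonneg (hη : ‖η‖ ≤ 1) (hw : w η = ‖w‖) {g : C₀(ℝ, ℝ)} (hg : ∀ x, 0 ≤ g x) :
    0 ≤ w (η * g) := by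
  have hc : 0 < ‖g‖ + 1 := by positivity
  have h : w (-((‖g‖ + 1)⁻¹ • (η * g))) ≤ 0 := by
    refine apply_le_zero_of_norm_add_le_one hw fun x => ?_
    have e : η x + (-((‖g‖ + 1)⁻¹ • (η * g))) x = η x * (1 - (‖g‖ + 1)⁻¹ * g x) := by
      simp
      ring
    have h1 : (‖g‖ + 1)⁻¹ * g x ≤ 1 := by
      rw [inv_mul_le_one₀ hc]
      linarith [(le_abs_self _).trans (abs_apply_le_norm g x)]
    have h2 : 0 ≤ (‖g‖ + 1)⁻¹ * g x := mul_nonneg (by positivity) (hg x)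
    rw [e, abs_mul]
    refine mul_le_one₀ ((abs_apply_le_norm η x).trans hη) (abs_nonneg _) ?_
    rw [abs_le]
    constructor <;> linarith
  rw [map_neg, map_smul, smul_eq_mul, neg_nonpos] at h
  exact nonneg_of_mul_nonneg_right h (by positivity)

/-- Perturb by `ε (1 - η²) g` with `ε = (2 (‖g‖ + 1))⁻¹`: its modulus is at most `1 - |η|`, because
`(1 + |η|) |g| ≤ 2 (‖g‖ + 1)`. -/
theorem apply_sub_mul_mul_nonpos (hη : ‖η‖ ≤ 1) (hw : w η = ‖w‖) (g : C₀(ℝ, ℝ)) :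
    w (g - η * (η * g)) ≤ 0 := by
  have hc : 0 < 2 * (‖g‖ + 1) := by positivity
  have h : w ((2 * (‖g‖ + 1))⁻¹ • (g - η * (η * g))) ≤ 0 := by
    refine apply_le_zero_of_norm_add_le_one hw fun x => ?_
    have hηx : |η x| ≤ 1 := (abs_apply_le_norm η x).trans hη
    have hgx : |g x| ≤ ‖g‖ := abs_apply_le_norm g x
    have e : (((2 * (‖g‖ + 1))⁻¹ • (g - η * (η * g))) : C₀(ℝ, ℝ)) x =
        (2 * (‖g‖ + 1))⁻¹ * ((1 - |η x|) * ((1 + |η x|) * g x)) := by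
      simp only [ZeroAtInftyContinuousMap.smul_apply, ZeroAtInftyContinuousMap.sub_apply,
        ZeroAtInftyContinuousMap.mul_apply, smul_eq_mul]
      congr 1
      linear_combination g x * sq_abs (η x)
    refine (abs_add_le _ _).trans ?_
    rw [e, abs_mul, abs_mul, abs_mul, abs_of_pos (inv_pos.mpr hc),
      abs_of_nonneg (sub_nonneg.mpr hηx), abs_of_nonneg (by positivity : 0 ≤ 1 + |η x|)]
    have h2 : (1 + |η x|) * |g x| ≤ 2 * (‖g‖ + 1) :=
      mul_le_mul (by linarith) (by linarith) (abs_nonneg _) (by norm_num)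
    have h3 : (2 * (‖g‖ + 1))⁻¹ * ((1 - |η x|) * ((1 + |η x|) * |g x|)) ≤ 1 - |η x| := by
      rw [inv_mul_le_iff₀ hc, mul_comm]
      exact mul_le_mul_of_nonneg_right h2 (by linarith)
    linarith
  rw [map_smul, smul_eq_mul] at h
  exact nonpos_of_mul_nonpos_right h (by positivity)

/-- The previous inequality for `g` and `-g`. It says that `w` ignores the region where `η² < 1`. -/
theorem apply_eq_apply_mul_mul (hη : ‖η‖ ≤ 1) (hw : w η = ‖w‖) (g : C₀(ℝ, ℝ)) :
    w g = w (η * (η * g)) := by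
  have h1 := apply_sub_mul_mul_nonpos hη hw g
  have h2 := apply_sub_mul_mul_nonpos hη hw (-g)
  have e : -g - η * (η * -g) = -(g - η * (η * g)) := by
    ext x
    simp
    ring
  rw [e, map_neg] at h2
  have h3 : w (g - η * (η * g)) = 0 := by linarith
  rwa [map_sub, sub_eq_zero] at h3

/-- Compactly supported functions are dense in `C₀(ℝ)`. -/
theorem denseRange_compactlySupported :
    DenseRange (fun g : C_c(ℝ, ℝ) => (g : C₀(ℝ, ℝ))) := by
  intro g
  rw [Metric.mem_closure_range_iff]
  intro ε hε
  have hev : ∀ᶠ x in cocompact ℝ, |g x| < ε / 2 := by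
    have h := g.zero_at_infty'.eventually (Metric.ball_mem_nhds (0 : ℝ) (by positivity : 0 < ε / 2))
    filter_upwards [h] with x hx
    simpa [Real.dist_eq] using hx
  obtain ⟨K, hK, hKg⟩ := mem_cocompact.mp hev
  -- Subtracting the truncation of `g` to `[-ε/2, ε/2]` costs at most `ε/2` and leaves zero wherever
  -- `|g| < ε/2`.
  let h : ℝ → ℝ := fun x => g x - max (-(ε / 2)) (min (ε / 2) (g x))
  have hcont : Continuous h := by
    have := g.continuous
    fun_prop
  have hsupp : HasCompactSupport h := by
    refine HasCompactSupport.intro hK fun x hx => ?_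
    have hx' : |g x| < ε / 2 := hKg hx
    rw [abs_lt] at hx'
    simp only [h]
    rw [min_eq_right hx'.2.le, max_eq_right hx'.1.le, sub_self]
  refine ⟨⟨⟨h, hcont⟩, hsupp⟩, ?_⟩
  rw [dist_eq_norm]
  refine lt_of_le_of_lt (norm_le_of_forall_abs_le (by positivity) fun x => ?_) (half_lt_self hε)
  change |g x - h x| ≤ ε / 2
  simp only [h, sub_sub_cancel]
  rw [abs_le]
  exact ⟨le_max_left _ _, max_le (by linarith) (min_le_left _ _)⟩

/-- The positive functional `g ↦ w (η g)`, for a functional `w` that attains its norm at `η`. -/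
def polarFunctional (hη : ‖η‖ ≤ 1) (hw : w η = ‖w‖) : C_c(ℝ, ℝ) →ₚ[ℝ] ℝ :=
  PositiveLinearMap.mk₀
    { toFun := fun g => w (η * (g : C₀(ℝ, ℝ)))
      map_add' := fun g h => by
        rw [← map_add, ← mul_add]
        rfl
      map_smul' := fun c g => by
        rw [RingHom.id_apply, ← map_smul, ← mul_smul_comm]
        rfl }
    fun _ hg => apply_mul_nonneg hη hw hg

theorem integrable_zeroAtInfty (μ : Measure ℝ) [IsFiniteMeasure μ] (g : C₀(ℝ, ℝ)) :
    Integrable g μ :=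
  Integrable.of_bound g.continuous.aestronglyMeasurable ‖g‖
    (Eventually.of_forall fun x => abs_apply_le_norm g x)

theorem continuous_integral_zeroAtInfty (μ : Measure ℝ) [IsFiniteMeasure μ] :
    Continuous (fun g : C₀(ℝ, ℝ) => ∫ x, g x ∂μ) := by
  refine LipschitzWith.continuous (K := (μ univ).toNNReal) ?_
  refine LipschitzWith.of_dist_le_mul fun g h => ?_
  rw [dist_eq_norm, dist_eq_norm,
    ← integral_sub (integrable_zeroAtInfty μ g) (integrable_zeroAtInfty μ h), mul_comm]
  exact norm_integral_le_of_norm_le_const (Eventually.of_forall fun x => abs_apply_le_norm (g - h) x)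

/-- Polar decomposition of a functional that attains its norm at `η`: it is `η μ` for a finite
positive measure `μ` that is concentrated on the compact set where `|η| = 1`. -/
theorem exists_measure_of_norm_attained (hη : ‖η‖ ≤ 1) (hw : w η = ‖w‖) :
    ∃ μ : Measure ℝ, IsFiniteMeasure μ ∧ (∀ᵐ x ∂μ, |η x| = 1) ∧
      (∃ S : ℝ, ∀ᵐ x ∂μ, x ∈ Icc (-S) S) ∧ (∀ g : C₀(ℝ, ℝ), w g = ∫ x, η x * g x ∂μ) ∧
      ‖w‖ = μ.real univ := by
  let μ := RealRMK.rieszMeasure (polarFunctional hη hw)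
  have hμ : ∀ g : C_c(ℝ, ℝ), ∫ x, g x ∂μ = w (η * (g : C₀(ℝ, ℝ))) := fun g =>
    RealRMK.integral_rieszMeasure (polarFunctional hη hw) g
  have hηx : ∀ x, |η x| ≤ 1 := fun x => (abs_apply_le_norm η x).trans hη
  have hae : ∀ᵐ x ∂μ, |η x| = 1 := by
    -- For a cutoff `χ`, the integral of `χ (1 - η²) ≥ 0` is `w (η χ) - w (η³ χ) = 0`. The cutoffs
    -- are needed because `μ` is not yet known to be finite.
    have hn : ∀ n : ℕ, ∀ᵐ x ∂μ, |x| ≤ (n + 1 : ℝ) → |η x| = 1 := by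
      intro n
      let χ : ContDiffBump (0 : ℝ) := ⟨n + 1, n + 2, by positivity, by linarith⟩
      let g₁ : C_c(ℝ, ℝ) := ⟨⟨χ, χ.continuous⟩, χ.hasCompactSupport⟩
      let g₂ : C_c(ℝ, ℝ) := ⟨⟨fun x => η x * (η x * χ x),
        η.continuous.mul (η.continuous.mul χ.continuous)⟩,
        χ.hasCompactSupport.mul_left.mul_left⟩
      have h0 : ∫ x, (g₁ x - g₂ x) ∂μ = 0 := by
        rw [integral_sub g₁.integrable g₂.integrable, hμ, hμ, sub_eq_zero,
          apply_eq_apply_mul_mul hη hw (η * (g₁ : C₀(ℝ, ℝ)))]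
        rfl
      have hnn : ∀ x, 0 ≤ g₁ x - g₂ x := by
        intro x
        change 0 ≤ χ x - η x * (η x * χ x)
        have h1 : η x * η x ≤ 1 := by
          rw [← abs_mul_abs_self]
          exact mul_le_one₀ (hηx x) (abs_nonneg _) (hηx x)
        nlinarith [χ.nonneg (x := x)]
      have h1 := (integral_eq_zero_iff_of_nonneg hnn (g₁.integrable.sub g₂.integrable)).mp h0
      filter_upwards [h1] with x hx hxn
      have hx1 : χ x - η x * (η x * χ x) = 0 := hx
      rw [χ.one_of_mem_closedBall (by simpa [χ, Real.dist_eq] using hxn)] at hx1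
      have h2 : |η x| ^ 2 = 1 := by rw [sq_abs]; linarith
      exact (pow_eq_one_iff_of_nonneg (abs_nonneg _) two_ne_zero).mp h2
    filter_upwards [ae_all_iff.mpr hn] with x hx
    obtain ⟨n, hxn⟩ := exists_nat_ge |x|
    exact hx n (by linarith)
  obtain ⟨S, hS⟩ : ∃ S : ℝ, ∀ x, |η x| = 1 → x ∈ Icc (-S) S := by
    have hev : ∀ᶠ x in cocompact ℝ, |η x| < 1 := by
      have h := η.zero_at_infty'.eventually (Metric.ball_mem_nhds (0 : ℝ) one_pos)
      filter_upwards [h] with x hx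
      simpa [Real.dist_eq] using hx
    obtain ⟨K, hK, hKη⟩ := mem_cocompact.mp hev
    obtain ⟨S, hS⟩ := hK.isBounded.subset_closedBall 0
    refine ⟨S, fun x hx => ?_⟩
    have hxK : x ∈ K := by_contra fun h => absurd (hKη h) (by simp [hx])
    have := hS hxK
    rwa [Real.closedBall_eq_Icc, zero_sub, zero_add] at this
  have hIcc : ∀ᵐ x ∂μ, x ∈ Icc (-S) S := hae.mono hS
  have hfin : IsFiniteMeasure μ := by
    refine ⟨?_⟩
    have h0 : μ (Icc (-S) S)ᶜ = 0 := hIcc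
    calc μ univ ≤ μ (Icc (-S) S) + μ (Icc (-S) S)ᶜ := by
          rw [← union_compl_self (Icc (-S) S)]
          exact measure_union_le _ _
      _ < ⊤ := by
          rw [h0, add_zero]
          exact isCompact_Icc.measure_lt_top
  -- Both sides are continuous in `g` once `μ` is finite, so density extends the Riesz formula from
  -- `C_c(ℝ)`.
  have hC₀ : ∀ g : C₀(ℝ, ℝ), ∫ x, g x ∂μ = w (η * g) := by
    have h : (fun g : C₀(ℝ, ℝ) => ∫ x, g x ∂μ) = fun g => w (η * g) :=
      denseRange_compactlySupported.equalizer (continuous_integral_zeroAtInfty μ)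
        (w.continuous.comp (continuous_const.mul continuous_id)) (funext hμ)
    exact fun g => congrFun h g
  have hrep : ∀ g : C₀(ℝ, ℝ), w g = ∫ x, η x * g x ∂μ := fun g => by
    rw [apply_eq_apply_mul_mul hη hw, ← hC₀]
    rfl
  refine ⟨μ, hfin, hae, ⟨S, hIcc⟩, hrep, ?_⟩
  rw [← hw, hrep]
  calc ∫ x, η x * η x ∂μ = ∫ _, (1 : ℝ) ∂μ := by
        refine integral_congr_ae (hae.mono fun x hx => ?_)
        change η x * η x = 1
        rw [← abs_mul_abs_self, hx, one_mul]
    _ = μ.real univ := by simp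

end NormAttaining

/-! ### Inverting `L` on compactly supported measures -/

section Convolution

/-- The functional `g ↦ ∫ θ g dμ`, for a finite measure `μ` and a density `θ` bounded by one. -/
def weighted (μ : Measure ℝ) [IsFiniteMeasure μ] (θ : ℝ → ℝ) (hθ : Measurable θ)
    (hb : ∀ x, |θ x| ≤ 1) : Meas :=
  LinearMap.mkContinuous
    { toFun := fun g : C₀(ℝ, ℝ) => ∫ x, θ x * g x ∂μ
      map_add' := fun g h => by
        rw [← integral_add ((integrable_zeroAtInfty μ g).bdd_mul hθ.aestronglyMeasurable
            (Eventually.of_forall hb)) ((integrable_zeroAtInfty μ h).bdd_mul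
            hθ.aestronglyMeasurable (Eventually.of_forall hb))]
        refine integral_congr_ae (Eventually.of_forall fun x => ?_)
        exact mul_add _ _ _
      map_smul' := fun c g => by
        rw [RingHom.id_apply, smul_eq_mul, ← integral_const_mul]
        refine integral_congr_ae (Eventually.of_forall fun x => ?_)
        exact mul_left_comm _ _ _ } (μ.real univ) (fun g => by
      rw [mul_comm]
      refine norm_integral_le_of_norm_le_const (Eventually.of_forall fun x => ?_)
      rw [norm_mul]
      exact (mul_le_of_le_one_left (norm_nonneg _) (hb x)).trans (abs_apply_le_norm g x))

variable {μ : Measure ℝ} [IsFiniteMeasure μ] {θ : ℝ → ℝ}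

theorem weighted_apply (hθ : Measurable θ) (hb : ∀ x, |θ x| ≤ 1) (g : C₀(ℝ, ℝ)) :
    weighted μ θ hθ hb g = ∫ x, θ x * g x ∂μ := rfl

theorem shift_ae_eq (a : ℝ) (f : Fn) : shift a f =ᵐ[volume] fun x => f (x - a) :=
  AEEqFun.coeFn_compMeasurePreserving f (measurePreserving_sub_right volume a)

theorem measurable_coe (f : Fn) : Measurable f := f.stronglyMeasurable.measurable

theorem shiftTest_shiftTest (a b : ℝ) (φ : 𝓢(ℝ, ℝ)) :
    shiftTest b (shiftTest a φ) = shiftTest (a + b) φ :=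
  SchwartzMap.compSubConstCLM_comp φ a b

namespace LSIOperator

variable {L : LSIOperator} {ρ : Fn}

theorem adj_shiftTest_ae_eq (y : ℝ) (φ : 𝓢(ℝ, ℝ)) :
    L.adj (shiftTest (-y) φ) =ᵐ[volume] fun x => L.adj φ (x + y) := by
  rw [L.adj_shift]
  refine (shift_ae_eq (-y) _).trans (Eventually.of_forall fun x => ?_)
  simp

theorem lintegral_shift_mul_adj (f : Fn) (y : ℝ) (φ : 𝓢(ℝ, ℝ)) :
    ∫⁻ x, ‖f (x - y) * L.adj φ x‖ₑ = ∫⁻ x, ‖f x * L.adj (shiftTest (-y) φ) x‖ₑ := by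
  rw [← lintegral_add_right_eq_self (fun x => ‖f (x - y) * L.adj φ x‖ₑ) y]
  refine lintegral_congr_ae ?_
  filter_upwards [adj_shiftTest_ae_eq (L := L) y φ] with x hx
  rw [hx, add_sub_cancel_right]

theorem integral_shift_mul_adj (f : Fn) (y : ℝ) (φ : 𝓢(ℝ, ℝ)) :
    ∫ x, f (x - y) * L.adj φ x = ∫ x, f x * L.adj (shiftTest (-y) φ) x := by
  rw [← integral_add_right_eq_self (fun x => f (x - y) * L.adj φ x) y]
  refine integral_congr_ae ?_
  filter_upwards [adj_shiftTest_ae_eq (L := L) y φ] with x hx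
  rw [hx, add_sub_cancel_right]

theorem op_spec (f : L.searchSpace) : L.Maps f (L.op f) := f.2.2.choose_spec

theorem Maps.op_eq {f : L.searchSpace} {w : Meas} (h : L.Maps f w) : L.op f = w :=
  (op_spec f).unique h

theorem IsGreen.integral_mul_adj (hρ : L.IsGreen ρ) (y : ℝ) (φ : 𝓢(ℝ, ℝ)) :
    ∫ x, ρ (x - y) * L.adj φ x = φ y := by
  obtain ⟨h, hδ⟩ := hρ
  rw [integral_shift_mul_adj]
  have := op_spec ⟨ρ, h⟩ (shiftTest (-y) φ)
  rw [hδ] at this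
  rw [this]
  change φ (0 - -y) = φ y
  rw [zero_sub, neg_neg]

/-- The convolution of a function with the measure `θ μ`. -/
def conv (f : Fn) (μ : Measure ℝ) [IsFiniteMeasure μ] (θ : ℝ → ℝ) (hθ : Measurable θ) : Fn :=
  AEEqFun.mk (fun x => ∫ y, f (x - y) * θ y ∂μ) (by
    have : Measurable (fun q : ℝ × ℝ => f (q.1 - q.2) * θ q.2) :=
      ((measurable_coe f).comp (measurable_fst.sub measurable_snd)).mul (hθ.comp measurable_snd)
    exact this.stronglyMeasurable.integral_prod_right.aestronglyMeasurable)

theorem conv_ae_eq (f : Fn) (hθ : Measurable θ) :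
    conv f μ θ hθ =ᵐ[volume] fun x => ∫ y, f (x - y) * θ y ∂μ :=
  AEEqFun.coeFn_mk _ _

theorem measurable_conv_kernel (f g : Fn) (hθ : Measurable θ) :
    Measurable (fun q : ℝ × ℝ => f (q.1 - q.2) * θ q.2 * g q.1) :=
  (((measurable_coe f).comp (measurable_fst.sub measurable_snd)).mul (hθ.comp measurable_snd)).mul
    ((measurable_coe g).comp measurable_fst)

/-- After Tonelli, translation by `y` becomes the shift `a - y` of the test function. Since `|a - y|
≤ R + S`, the locally uniform bound in `Applies` at radius `R + S` controls every inner integral. -/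
theorem Applies.lintegral_lintegral_le {f : Fn} (hf : L.Applies f) (hb : ∀ x, |θ x| ≤ 1) {S : ℝ}
    (hS : ∀ᵐ x ∂μ, x ∈ Icc (-S) S) (hθ : Measurable θ) (φ : 𝓢(ℝ, ℝ)) (R : ℝ) :
    ∃ C : ℝ≥0, ∀ a ∈ Icc (-R) R,
      ∫⁻ x, ∫⁻ y, ‖f (x - y) * θ y * L.adj (shiftTest a φ) x‖ₑ ∂μ ≤ C := by
  obtain ⟨C, hC⟩ := hf φ (R + S)
  refine ⟨C * (μ univ).toNNReal, fun a ha => ?_⟩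
  rw [lintegral_lintegral_swap
    (measurable_conv_kernel f (L.adj (shiftTest a φ)) hθ).enorm.aemeasurable]
  calc ∫⁻ y, ∫⁻ x, ‖f (x - y) * θ y * L.adj (shiftTest a φ) x‖ₑ ∂volume ∂μ
      ≤ ∫⁻ _, (C : ℝ≥0∞) ∂μ := by
        refine lintegral_mono_ae (hS.mono fun y hy => ?_)
        calc ∫⁻ x, ‖f (x - y) * θ y * L.adj (shiftTest a φ) x‖ₑ
            ≤ ∫⁻ x, ‖f (x - y) * L.adj (shiftTest a φ) x‖ₑ := by
              refine lintegral_mono fun x => ?_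
              rw [mul_right_comm, enorm_mul _ (θ y)]
              refine mul_le_of_le_one_right' ?_
              rw [← ofReal_norm]
              exact ENNReal.ofReal_le_one.mpr (hb y)
          _ = ∫⁻ x, ‖f x * L.adj (shiftTest (a + -y) φ) x‖ₑ := by
              rw [lintegral_shift_mul_adj, shiftTest_shiftTest]
          _ ≤ C := hC _ ⟨by linarith [ha.1, hy.2], by linarith [ha.2, hy.1]⟩
    _ = ((C * (μ univ).toNNReal : ℝ≥0) : ℝ≥0∞) := by
        rw [lintegral_const, ENNReal.coe_mul, ENNReal.coe_toNNReal (measure_ne_top μ univ)]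

theorem Applies.conv {f : Fn} (hf : L.Applies f) (hθ : Measurable θ) (hb : ∀ x, |θ x| ≤ 1) {S : ℝ}
    (hS : ∀ᵐ x ∂μ, x ∈ Icc (-S) S) : L.Applies (conv f μ θ hθ) := by
  intro φ R
  obtain ⟨C, hC⟩ := hf.lintegral_lintegral_le hb hS hθ φ R
  refine ⟨C, fun a ha => le_trans (lintegral_mono_ae ?_) (hC a ha)⟩
  filter_upwards [conv_ae_eq (μ := μ) f hθ] with x hx
  rw [hx, ← integral_mul_const]
  exact enorm_integral_le_lintegral_enorm _

/-- Convolution of a Green's function with a compactly supported measure inverts `L`. -/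
theorem IsGreen.maps_conv (hρ : L.IsGreen ρ) (hθ : Measurable θ) (hb : ∀ x, |θ x| ≤ 1) {S : ℝ}
    (hS : ∀ᵐ x ∂μ, x ∈ Icc (-S) S) : L.Maps (conv ρ μ θ hθ) (weighted μ θ hθ hb) := by
  intro φ
  have hint : Integrable (Function.uncurry fun x y => ρ (x - y) * θ y * L.adj φ x)
      (volume.prod μ) := by
    have hm := measurable_conv_kernel ρ (L.adj φ) hθ
    refine ⟨hm.aestronglyMeasurable, ?_⟩
    obtain ⟨C, hC⟩ := hρ.1.1.lintegral_lintegral_le hb hS hθ φ 0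
    have h := hC 0 (by simp)
    rw [shiftTest_zero] at h
    exact lt_of_le_of_lt ((lintegral_prod _ hm.enorm.aemeasurable).trans_le h) ENNReal.coe_lt_top
  calc ∫ x, conv ρ μ θ hθ x * L.adj φ x
      = ∫ x, ∫ y, ρ (x - y) * θ y * L.adj φ x ∂μ := by
        refine integral_congr_ae ?_
        filter_upwards [conv_ae_eq (μ := μ) ρ hθ] with x hx
        rw [hx, ← integral_mul_const]
    _ = ∫ y, ∫ x, ρ (x - y) * θ y * L.adj φ x ∂volume ∂μ := integral_integral_swap hint
    _ = ∫ y, θ y * φ y ∂μ := by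
        refine integral_congr_ae (Eventually.of_forall fun y => ?_)
        change ∫ x, ρ (x - y) * θ y * L.adj φ x = θ y * φ y
        rw [← hρ.integral_mul_adj y φ, ← integral_const_mul]
        refine integral_congr_ae (Eventually.of_forall fun x => ?_)
        change ρ (x - y) * θ y * L.adj φ x = θ y * (ρ (x - y) * L.adj φ x)
        ring
    _ = weighted μ θ hθ hb φ.toZeroAtInfty := rfl

theorem IsGreen.exists_op_eq_weighted (hρ : L.IsGreen ρ) (hθ : Measurable θ)
    (hb : ∀ x, |θ x| ≤ 1) {S : ℝ} (hS : ∀ᵐ x ∂μ, x ∈ Icc (-S) S) :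
    ∃ f : L.searchSpace, L.op f = weighted μ θ hθ hb :=
  ⟨⟨_, hρ.1.1.conv hθ hb hS, _, hρ.maps_conv hθ hb hS⟩, Maps.op_eq (hρ.maps_conv hθ hb hS)⟩

theorem IsGreen.shift_mem (hρ : L.IsGreen ρ) (y : ℝ) : shift y ρ ∈ L.searchSpace := by
  refine ⟨fun φ R => ?_, dirac y, fun φ => ?_⟩
  · obtain ⟨C, hC⟩ := hρ.1.1 φ (R + |y|)
    refine ⟨C, fun a ha => ?_⟩
    have h := hC (a + -y) ⟨by linarith [ha.1, le_abs_self y], by linarith [ha.2, neg_abs_le y]⟩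
    rw [← shiftTest_shiftTest, ← lintegral_shift_mul_adj] at h
    refine le_trans (le_of_eq (lintegral_congr_ae ?_)) h
    filter_upwards [shift_ae_eq y ρ] with x hx
    rw [hx]
  · refine Eq.trans (integral_congr_ae ?_) (hρ.integral_mul_adj y φ)
    filter_upwards [shift_ae_eq y ρ] with x hx
    rw [hx]

theorem IsGreen.op_shift (hρ : L.IsGreen ρ) (y : ℝ) : L.op ⟨shift y ρ, hρ.shift_mem y⟩ = dirac y := by
  refine Maps.op_eq fun φ => Eq.trans (integral_congr_ae ?_) (hρ.integral_mul_adj y φ)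
  filter_upwards [shift_ae_eq y ρ] with x hx
  rw [hx]

end LSIOperator

end Convolution

/-! ### Krein–Milman and the embedding of `𝓧₁` -/

/-- The Krein–Milman theorem for the topology induced by an injective linear map. -/
theorem closure_convexHull_extremePoints_induced {X Y : Type*} [AddCommGroup X] [Module ℝ X]
    [AddCommGroup Y] [Module ℝ Y] [t : TopologicalSpace Y] [IsTopologicalAddGroup Y]
    [ContinuousSMul ℝ Y] [LocallyConvexSpace ℝ Y] [T2Space Y] (J : X →ₗ[ℝ] Y)
    (hJ : Function.Injective J) {s : Set X} (hs : @IsCompact X (t.induced J) s)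
    (hc : Convex ℝ s) :
    closure[t.induced J] (convexHull ℝ (s.extremePoints ℝ)) = s := by
  let _ : TopologicalSpace X := t.induced J
  have : IsTopologicalAddGroup X := topologicalAddGroup_induced J
  have : ContinuousSMul ℝ X := continuousSMul_induced J.toMulActionHom
  have : LocallyConvexSpace ℝ X := LocallyConvexSpace.induced J
  have : T2Space X := T2Space.of_injective_continuous hJ continuous_induced_dom
  exact closure_convexHull_extremePoints hs hc

theorem locallyConvexSpace_weakDual {V : Type*} [NormedAddCommGroup V] [NormedSpace ℝ V] :
    LocallyConvexSpace ℝ (WeakDual ℝ V) :=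
  WeakBilin.locallyConvexSpace (B := topDualPairing ℝ V)

theorem closure_convexHull_extremePoints_induced_weakDual {X V : Type*} [AddCommGroup X]
    [Module ℝ X] [NormedAddCommGroup V] [NormedSpace ℝ V] {N : ℕ}
    (J : X →ₗ[ℝ] WeakDual ℝ V × (Fin N → ℝ)) (hJ : Function.Injective J) {s : Set X}
    (hs : @IsCompact X (TopologicalSpace.induced J inferInstance) s) (hc : Convex ℝ s) :
    closure[TopologicalSpace.induced J inferInstance] (convexHull ℝ (s.extremePoints ℝ)) = s := by
  have : LocallyConvexSpace ℝ (WeakDual ℝ V) := locallyConvexSpace_weakDual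
  exact closure_convexHull_extremePoints_induced J hJ hs hc

theorem norm_smul_add_smul_le {V : Type*} [NormedAddCommGroup V] [NormedSpace ℝ V] (a b : ℝ≥0)
    (v w : StrongDual ℝ V) : ‖(a : ℝ) • v + (b : ℝ) • w‖ ≤ a * ‖v‖ + b * ‖w‖ := by
  refine (norm_add_le _ _).trans (le_of_eq ?_)
  rw [norm_smul, norm_smul, Real.norm_of_nonneg a.coe_nonneg, Real.norm_of_nonneg b.coe_nonneg]

namespace LSIOperator

variable {L : LSIOperator} {M N₀ : ℕ} {ρ : Fn} {p : Module.Basis (Fin N₀) ℝ L.nullSpace}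
  {φ : Fin N₀ → L.searchSpace →ₗ[ℝ] ℝ} {H : L.searchSpace →ₗ[ℝ] (Fin M → ℝ)}
  {E : (Fin M → ℝ) → (Fin M → ℝ) → ℝ≥0∞} {z : Fin M → ℝ} {lam : ℝ}

/-- The map `f ↦ (L f, (⟨φ_n, f⟩)_n)`. -/
def embed (φ : Fin N₀ → L.searchSpace →ₗ[ℝ] ℝ) :
    L.searchSpace →ₗ[ℝ] WeakDual ℝ C₀(ℝ, ℝ) × (Fin N₀ → ℝ) :=
  (StrongDual.toWeakDual.toLinearMap ∘ₗ L.op).prod (LinearMap.pi φ)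

theorem weakStar_eq_induced (φ : Fin N₀ → L.searchSpace →ₗ[ℝ] ℝ) :
    L.weakStar φ = TopologicalSpace.induced (embed φ) inferInstance := by
  have hi : IsInducing (fun (w : WeakDual ℝ C₀(ℝ, ℝ)) (ψ : C₀(ℝ, ℝ)) => w ψ) := ⟨rfl⟩
  rw [(hi.prodMap (IsInducing.id (X := Fin N₀ → ℝ))).eq_induced, induced_compose]
  rfl

theorem Biorthonormal.apply_sum (hφ : L.Biorthonormal p φ) (c : Fin N₀ → ℝ) (m : Fin N₀) :
    φ m (∑ n, c n • (p n : L.searchSpace)) = c m := by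
  simp [hφ m]

theorem op_sum_basis (c : Fin N₀ → ℝ) : L.op (∑ n, c n • (p n : L.searchSpace)) = 0 := by
  rw [map_sum]
  refine Finset.sum_eq_zero fun n _ => ?_
  rw [map_smul, LinearMap.mem_ker.mp (p n).2, smul_zero]

theorem exists_eq_sum_basis (p : Module.Basis (Fin N₀) ℝ L.nullSpace) {f : L.searchSpace}
    (hf : L.op f = 0) : ∃ c : Fin N₀ → ℝ, f = ∑ n, c n • (p n : L.searchSpace) := by
  refine ⟨p.repr ⟨f, hf⟩, ?_⟩
  have h := congrArg (Submodule.subtype L.nullSpace) (p.sum_repr ⟨f, hf⟩)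
  rw [map_sum] at h
  exact h.symm

theorem Biorthonormal.embed_injective (hφ : L.Biorthonormal p φ) :
    Function.Injective (embed φ) := by
  rw [injective_iff_map_eq_zero]
  intro f hf
  have h1 : L.op f = 0 := congrArg Prod.fst hf
  have h2 : ∀ n, φ n f = 0 := fun n => congrFun (congrArg Prod.snd hf) n
  obtain ⟨c, rfl⟩ := exists_eq_sum_basis p h1
  refine Finset.sum_eq_zero fun n _ => ?_
  rw [← hφ.apply_sum c n, h2 n, zero_smul]

theorem Biorthonormal.embed_sum (hφ : L.Biorthonormal p φ) (c : Fin N₀ → ℝ) :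
    embed φ (∑ n, c n • (p n : L.searchSpace)) = (0, c) := by
  refine Prod.ext ?_ (funext fun n => hφ.apply_sum c n)
  exact congrArg StrongDual.toWeakDual (op_sum_basis c)

/-- Null-space elements adjust the coordinates `⟨φ_n, f⟩` freely without changing `L f`, so only the
measure component can obstruct membership in the range. -/
theorem Biorthonormal.mem_range_embed (hφ : L.Biorthonormal p φ) (f : L.searchSpace)
    (c : Fin N₀ → ℝ) : (StrongDual.toWeakDual (L.op f), c) ∈ range (embed φ) := by
  refine ⟨f + ∑ n, (c n - φ n f) • (p n : L.searchSpace), ?_⟩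
  rw [map_add, hφ.embed_sum (fun n => c n - φ n f)]
  refine Prod.ext (add_zero _) (funext fun n => ?_)
  change φ n f + (c n - φ n f) = c n
  ring

/-- A weak*-continuous functional on the search space is a combination of evaluations. -/
theorem exists_eq_of_continuous {g : L.searchSpace →ₗ[ℝ] ℝ}
    (hg : Continuous[L.weakStar φ, inferInstance] g) :
    ∃ (ψ : C₀(ℝ, ℝ)) (c : Fin N₀ → ℝ), ∀ f, g f = L.op f ψ + ∑ n, c n * φ n f := by
  let F : C₀(ℝ, ℝ) ⊕ Fin N₀ → L.searchSpace →ₗ[ℝ] ℝ :=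
    Sum.elim (fun ψ => (ContinuousLinearMap.apply ℝ ℝ ψ).toLinearMap ∘ₗ L.op) φ
  have hmem : g ∈ Submodule.span ℝ (range F) := by
    -- A linear functional continuous for the topology generated by a family of functionals lies in
    -- their span.
    rw [LinearMap.mem_span_iff_continuous]
    refine continuous_le_dom ?_ hg
    let _ : TopologicalSpace L.searchSpace := ⨅ i, TopologicalSpace.induced (F i) inferInstance
    have hF : ∀ i, Continuous (F i) := fun i => continuous_iInf_dom continuous_induced_dom
    exact continuous_iff_le_induced.mp ((continuous_pi fun ψ => hF (Sum.inl ψ)).prodMk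
      (continuous_pi fun n => hF (Sum.inr n)))
  clear hg
  induction hmem using Submodule.span_induction with
  | mem g hg =>
    obtain ⟨ψ | n, rfl⟩ := hg
    · exact ⟨ψ, 0, fun f => by simp [F]⟩
    · exact ⟨0, Pi.single n 1, fun f => by simp [F, Pi.single_apply]⟩
  | zero => exact ⟨0, 0, fun f => by simp⟩
  | add g g' _ _ h h' =>
    obtain ⟨ψ, c, h⟩ := h
    obtain ⟨ψ', c', h'⟩ := h'
    refine ⟨ψ + ψ', c + c', fun f => ?_⟩
    rw [LinearMap.add_apply, h, h', map_add]
    simp only [Pi.add_apply, add_mul, Finset.sum_add_distrib]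
    ring
  | smul a g _ h =>
    obtain ⟨ψ, c, h⟩ := h
    refine ⟨a • ψ, a • c, fun f => ?_⟩
    rw [LinearMap.smul_apply, h, map_smul]
    simp only [Pi.smul_apply, smul_eq_mul, mul_assoc, mul_add, Finset.mul_sum]

/-- A weak*-continuous measurement operator factors through `embed`. -/
theorem exists_factor (hH : Continuous[L.weakStar φ, inferInstance] H) :
    ∃ (A : WeakDual ℝ C₀(ℝ, ℝ) × (Fin N₀ → ℝ) →L[ℝ] (Fin M → ℝ)) (ψ : Fin M → C₀(ℝ, ℝ)),
      (∀ f, A (embed φ f) = H f) ∧ ∀ w i, A (w, 0) i = w (ψ i) := by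
  have h : ∀ i, ∃ (ψ : C₀(ℝ, ℝ)) (c : Fin N₀ → ℝ), ∀ f,
      H f i = L.op f ψ + ∑ n, c n * φ n f := fun i =>
    exists_eq_of_continuous (g := LinearMap.proj i ∘ₗ H) (by
      let _ : TopologicalSpace L.searchSpace := L.weakStar φ
      exact (continuous_apply i).comp hH)
  choose ψ c h using h
  let ev : C₀(ℝ, ℝ) → WeakDual ℝ C₀(ℝ, ℝ) →L[ℝ] ℝ := fun ψ =>
    { toFun := fun w => w ψ
      map_add' := fun _ _ => rfl
      map_smul' := fun _ _ => rfl
      cont := WeakDual.eval_continuous ψ }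
  have hev : ∀ ψ w, ev ψ w = w ψ := fun _ _ => rfl
  refine ⟨ContinuousLinearMap.pi fun i => (ev (ψ i)).comp (ContinuousLinearMap.fst ℝ _ _) +
    (∑ n, c i n • ContinuousLinearMap.proj (R := ℝ) (φ := fun _ : Fin N₀ => ℝ) n).comp
      (ContinuousLinearMap.snd ℝ _ _), ψ, fun f => ?_, fun w i => ?_⟩
  · ext i
    rw [h]
    simp [embed, hev]
  · simp [hev]

theorem cost_eq_dualCost {A : WeakDual ℝ C₀(ℝ, ℝ) × (Fin N₀ → ℝ) →L[ℝ] (Fin M → ℝ)}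
    (hA : ∀ f, A (embed φ f) = H f) (f : L.searchSpace) :
    L.cost E z lam H f = dualCost (E z) lam A (embed φ f) := by
  rw [dualCost, hA]
  rfl

theorem convex_minimizers (hconv : ConvexOn ℝ≥0 univ (E z)) (hlam : 0 < lam) :
    Convex ℝ (L.minimizers E z lam H) := by
  intro f hf g hg a b ha hb hab k
  -- The weights become nonnegative reals so that they can act on the extended values of the cost.
  lift a to ℝ≥0 using ha
  lift b to ℝ≥0 using hb
  have hab' : a + b = 1 := by exact_mod_cast hab
  have h1 : E z (H ((a : ℝ) • f + (b : ℝ) • g)) ≤ a • E z (H f) + b • E z (H g) := by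
    rw [map_add, map_smul, map_smul]
    exact hconv.2 (mem_univ _) (mem_univ _) zero_le zero_le hab'
  have h2 : ENNReal.ofReal (lam * ‖L.op ((a : ℝ) • f + (b : ℝ) • g)‖) ≤
      a • ENNReal.ofReal (lam * ‖L.op f‖) + b • ENNReal.ofReal (lam * ‖L.op g‖) := by
    rw [ENNReal.smul_def, ENNReal.smul_def, smul_eq_mul, smul_eq_mul,
      ← ENNReal.ofReal_coe_nnreal (p := a), ← ENNReal.ofReal_coe_nnreal (p := b),
      ← ENNReal.ofReal_mul a.coe_nonneg, ← ENNReal.ofReal_mul b.coe_nonneg, ← ENNReal.ofReal_add (by positivity)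
      (by positivity)]
    refine ENNReal.ofReal_le_ofReal ?_
    rw [map_add, map_smul, map_smul]
    have h3 := norm_smul_add_smul_le a b (L.op f) (L.op g)
    calc _ ≤ lam * (a * ‖L.op f‖ + b * ‖L.op g‖) := mul_le_mul_of_nonneg_left h3 hlam.le
      _ = _ := by ring
  calc L.cost E z lam H ((a : ℝ) • f + (b : ℝ) • g)
      ≤ (a • E z (H f) + b • E z (H g)) + (a • ENNReal.ofReal (lam * ‖L.op f‖) +
        b • ENNReal.ofReal (lam * ‖L.op g‖)) := add_le_add h1 h2
    _ = a • L.cost E z lam H f + b • L.cost E z lam H g := by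
        rw [cost, cost, smul_add, smul_add, add_add_add_comm]
    _ ≤ a • L.cost E z lam H k + b • L.cost E z lam H k := by
        gcongr
        · exact hf k
        · exact hg k
    _ = L.cost E z lam H k := by rw [← add_smul, hab', one_smul]

end LSIOperator

/-! ### Perturbations of a polar decomposition -/

/-- The polar decomposition `w = η μ` of a measure whose norm is attained at `η`. -/
structure IsPolar (w : Meas) (η : C₀(ℝ, ℝ)) (μ : Measure ℝ) : Prop where
  isFinite : IsFiniteMeasure μ
  norm_le_one : ‖η‖ ≤ 1
  abs_eq_one : ∀ᵐ x ∂μ, |η x| = 1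
  bounded : ∃ S : ℝ, ∀ᵐ x ∂μ, x ∈ Icc (-S) S
  apply_eq : ∀ g : C₀(ℝ, ℝ), w g = ∫ x, η x * g x ∂μ
  norm_eq : ‖w‖ = μ.real univ

/-- `τ` vanishes almost everywhere, and its zero set is closed, so it contains the support. -/
theorem eqOn_support_of_integral_sq_eq_zero {μ : Measure ℝ} [IsFiniteMeasure μ] {τ : C₀(ℝ, ℝ)}
    (h : ∫ x, τ x * τ x ∂μ = 0) {x : ℝ} (hx : x ∈ μ.support) : τ x = 0 := by
  have h1 : ∀ᵐ x ∂μ, τ x * τ x = 0 :=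
    (integral_eq_zero_iff_of_nonneg (fun x => mul_self_nonneg (τ x))
      (integrable_zeroAtInfty μ (τ * τ))).mp h
  have hcl : IsClosed {x | τ x = 0} := isClosed_eq τ.continuous continuous_const
  exact Measure.support_subset_of_isClosed hcl (h1.mono fun x hx => mul_self_eq_zero.mp hx) hx

theorem eq_zero_of_sum_basis_eq_zero {X ι : Type*} [AddCommGroup X] [Module ℝ X] [Fintype ι]
    {W : Submodule ℝ X} (p : Module.Basis ι ℝ W) {c : ι → ℝ}
    (h : ∑ n, c n • (p n : X) = 0) : c = 0 := by
  have h1 : ∑ n, c n • p n = 0 := Subtype.ext (by simpa using h)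
  exact funext (Fintype.linearIndependent_iff.mp p.linearIndependent c h1)

theorem sum_smul_apply {K : ℕ} (t : Fin K → ℝ) (χ : Fin K → C₀(ℝ, ℝ)) (y : ℝ) :
    (∑ k, t k • χ k : C₀(ℝ, ℝ)) y = ∑ k, t k * χ k y :=
  map_sum (dirac y) (fun k => t k • χ k) Finset.univ

/-- Interpolation at finitely many points by functions in `C₀(ℝ)` with values in `[0, 1]`. -/
theorem exists_interpolation {K : ℕ} {x : Fin K → ℝ} (hx : Function.Injective x) :
    ∃ χ : Fin K → C₀(ℝ, ℝ), (∀ k y, |χ k y| ≤ 1) ∧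
      ∀ k j, χ k (x j) = if k = j then 1 else 0 := by
  have h : ∀ k, ∃ χ : C₀(ℝ, ℝ), (∀ y, |χ y| ≤ 1) ∧ ∀ j, χ (x j) = if k = j then 1 else 0 := by
    intro k
    obtain ⟨f, h1, h0, hs, h01⟩ := exists_continuous_one_zero_of_isCompact
      (isCompact_singleton (x := x k)) ((finite_range x).subset (sdiff_subset (t := {x k}))).isClosed
      (disjoint_singleton_left.mpr (by simp))
    refine ⟨⟨f, hs.is_zero_at_infty⟩, fun y => ?_, fun j => ?_⟩
    · change |f y| ≤ 1
      rw [abs_of_nonneg (h01 y).1]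
      exact (h01 y).2
    · change f (x j) = _
      split_ifs with hkj
      · subst hkj
        exact h1 rfl
      · exact h0 ⟨mem_range_self j, fun h => hkj (hx h).symm⟩
  choose χ h1 h2 using h
  exact ⟨χ, h1, h2⟩

namespace IsPolar

variable {w : Meas} {η : C₀(ℝ, ℝ)} {μ : Measure ℝ}

theorem abs_apply_le_one (h : IsPolar w η μ) (x : ℝ) : |η x| ≤ 1 :=
  (abs_apply_le_norm η x).trans h.norm_le_one

/-- Small perturbations `η (1 + s τ) μ` of `η μ` change the norm at most by `s ∫ τ dμ`. -/
theorem norm_add_smul_le (h : IsPolar w η μ) {v : Meas} {τ : C₀(ℝ, ℝ)}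
    (hv : ∀ g : C₀(ℝ, ℝ), v g = ∫ x, η x * τ x * g x ∂μ) {s : ℝ} (hs : |s| * ‖τ‖ ≤ 1) :
    ‖w + s • v‖ ≤ ‖w‖ + s * ∫ x, τ x ∂μ := by
  have := h.isFinite
  -- Nonnegativity of `1 + s τ` removes the absolute value, which makes the bound affine in `s`.
  have hpos : ∀ x, 0 ≤ 1 + s * τ x := by
    intro x
    have h1 : |s * τ x| ≤ 1 := by
      rw [abs_mul]
      exact (mul_le_mul_of_nonneg_left (abs_apply_le_norm τ x) (abs_nonneg s)).trans hs
    linarith [(abs_le.mp h1).1]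
  have hint : Integrable (fun x => 1 + s * τ x) μ :=
    (integrable_const 1).add ((integrable_zeroAtInfty μ τ).const_mul s)
  have htot : ∫ x, (1 + s * τ x) ∂μ = ‖w‖ + s * ∫ x, τ x ∂μ := by
    rw [integral_add (integrable_const 1) ((integrable_zeroAtInfty μ τ).const_mul s),
      integral_const_mul, h.norm_eq]
    simp
  rw [← htot]
  refine ContinuousLinearMap.opNorm_le_bound _ (integral_nonneg hpos) fun g => ?_
  have e : (w + s • v) g = ∫ x, η x * (1 + s * τ x) * g x ∂μ := by
    have e0 : (w + s • v) g = w g + s * v g := rfl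
    rw [e0, h.apply_eq, hv, ← integral_const_mul, ← integral_add]
    · refine integral_congr_ae (Eventually.of_forall fun x => ?_)
      change η x * g x + s * (η x * τ x * g x) = η x * (1 + s * τ x) * g x
      ring
    · exact integrable_zeroAtInfty μ (η * g)
    · exact (integrable_zeroAtInfty μ (η * τ * g)).const_mul s
  rw [e, ← integral_mul_const]
  refine norm_integral_le_of_norm_le (hint.mul_const _) (Eventually.of_forall fun x => ?_)
  rw [norm_mul, norm_mul, Real.norm_of_nonneg (hpos x)]
  refine mul_le_mul ?_ (abs_apply_le_norm g x) (norm_nonneg _) (hpos x)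
  exact mul_le_of_le_one_left (hpos x) (h.abs_apply_le_one x)

/-- A polar decomposition with finite support is a finite sum of Dirac masses. -/
theorem eq_sum_dirac (h : IsPolar w η μ) {K : ℕ} {x : Fin K → ℝ} (hx : Function.Injective x)
    (hsupp : ∀ᵐ y ∂μ, y ∈ range x) :
    ∃ a : Fin K → ℝ, w = ∑ k, a k • dirac (x k) ∧ ‖w‖ = ∑ k, |a k| := by
  classical
  have := h.isFinite
  have hsum : ∀ g : ℝ → ℝ, ∫ y, g y ∂μ = ∑ k, μ.real {x k} * g (x k) := by
    intro g
    have hr : μ.restrict (Finset.univ.image x : Finset ℝ) = μ :=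
      Measure.restrict_eq_self_of_ae_mem (by simpa using hsupp)
    conv_lhs => rw [← hr]
    rw [setIntegral_finset _ IntegrableOn.finset, Finset.sum_image hx.injOn]
    rfl
  refine ⟨fun k => μ.real {x k} * η (x k), ?_, ?_⟩
  · ext g
    rw [h.apply_eq, hsum, _root_.sum_apply]
    refine Finset.sum_congr rfl fun k _ => ?_
    change _ = μ.real {x k} * η (x k) * g (x k)
    ring
  · have h1 : μ.real univ = ∫ _, (1 : ℝ) ∂μ := by simp
    rw [h.norm_eq, h1, hsum]
    refine Finset.sum_congr rfl fun k _ => ?_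
    rw [abs_mul, abs_of_nonneg measureReal_nonneg]
    -- A point of positive mass cannot lie in the null set where `|η| ≠ 1`.
    by_cases h0 : μ {x k} = 0
    · simp [measureReal_def, h0]
    · have : |η (x k)| = 1 := by
        by_contra hne
        refine h0 (measure_mono_null ?_ (h.abs_eq_one : μ {y | |η y| = 1}ᶜ = 0))
        exact singleton_subset_iff.mpr hne
      rw [this]

end IsPolar

/-! ### Extreme minimizers have few knots -/

namespace LSIOperator

variable {L : LSIOperator} {M N₀ : ℕ} {ρ : Fn} {p : Module.Basis (Fin N₀) ℝ L.nullSpace}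
  {φ : Fin N₀ → L.searchSpace →ₗ[ℝ] ℝ} {H : L.searchSpace →ₗ[ℝ] (Fin M → ℝ)}
  {E : (Fin M → ℝ) → (Fin M → ℝ) → ℝ≥0∞} {z : Fin M → ℝ} {lam : ℝ}
  {η : C₀(ℝ, ℝ)} {μ : Measure ℝ}

theorem IsGreen.exists_op_eq (hρ : L.IsGreen ρ) {w : Meas} (h : IsPolar w η μ) :
    ∃ f : L.searchSpace, L.op f = w := by
  have := h.isFinite
  obtain ⟨S, hS⟩ := h.bounded
  obtain ⟨f, hf⟩ := hρ.exists_op_eq_weighted η.continuous.measurable h.abs_apply_le_one hS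
  refine ⟨f, hf.trans ?_⟩
  ext g
  rw [weighted_apply, h.apply_eq]
  rfl

theorem norm_op_le_of_mem_minimizers (hfeas : ∃ f, E z (H f) ≠ ⊤) (hlam : 0 < lam)
    {f g : L.searchSpace} (hf : f ∈ L.minimizers E z lam H) (hg : H g = H f) :
    ‖L.op f‖ ≤ ‖L.op g‖ := by
  obtain ⟨f₀, h₀⟩ := hfeas
  have hfin : L.cost E z lam H f ≠ ⊤ :=
    ne_top_of_le_ne_top (ENNReal.add_ne_top.mpr ⟨h₀, ENNReal.ofReal_ne_top⟩) (hf f₀)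
  have h1 := hf g
  rw [cost, cost, hg, ENNReal.add_le_add_iff_left (ENNReal.add_ne_top.mp hfin).1,
    ENNReal.ofReal_le_ofReal_iff (by positivity)] at h1
  exact le_of_mul_le_mul_left h1 hlam

theorem mem_minimizers_of_norm_op_le (hlam : 0 < lam) {f g : L.searchSpace}
    (hf : f ∈ L.minimizers E z lam H) (hg : H g = H f) (hle : ‖L.op g‖ ≤ ‖L.op f‖) :
    g ∈ L.minimizers E z lam H := by
  intro k
  refine le_trans ?_ (hf k)
  rw [cost, cost, hg]
  gcongr

/-- An extreme minimizer admits no perturbation `h` with `H h = 0` and `L h = η τ μ`, where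
`L f = η μ`. -/
theorem eq_zero_of_mem_extremePoints (hfeas : ∃ f, E z (H f) ≠ ⊤) (hlam : 0 < lam)
    {f : L.searchSpace} (hf : f ∈ (L.minimizers E z lam H).extremePoints ℝ)
    (hpol : IsPolar (L.op f) η μ) {h : L.searchSpace} (hh : H h = 0) {τ : C₀(ℝ, ℝ)}
    (hτ : ∀ g : C₀(ℝ, ℝ), L.op h g = ∫ x, η x * τ x * g x ∂μ) : h = 0 := by
  have hpos : 0 < ‖τ‖ + 1 := by positivity
  let s : ℝ := (‖τ‖ + 1)⁻¹
  have hs : 0 < s := inv_pos.mpr hpos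
  have hs1 : s * ‖τ‖ ≤ 1 := by
    rw [inv_mul_le_one₀ hpos]
    linarith
  have hH : ∀ r : ℝ, H (f + r • h) = H f := fun r => by
    rw [map_add, map_smul, hh, smul_zero, add_zero]
  have hle : ∀ r : ℝ, |r| * ‖τ‖ ≤ 1 → ‖L.op (f + r • h)‖ ≤ ‖L.op f‖ + r * ∫ x, τ x ∂μ :=
    fun r hr => by
      rw [map_add, map_smul]
      exact hpol.norm_add_smul_le hτ hr
  have hge : ∀ r : ℝ, ‖L.op f‖ ≤ ‖L.op (f + r • h)‖ := fun r =>
    norm_op_le_of_mem_minimizers hfeas hlam hf.1 (hH r)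
  have hr1 : |s| * ‖τ‖ ≤ 1 := by rwa [abs_of_pos hs]
  have hr2 : |-s| * ‖τ‖ ≤ 1 := by rwa [abs_neg]
  have h1 := (hge s).trans (hle s hr1)
  have h2 := (hge (-s)).trans (hle (-s) hr2)
  -- Minimality at `s` and at `-s` forces both signs, so both perturbed functions are minimizers
  -- with midpoint `f`.
  have h3 : s * ∫ x, τ x ∂μ = 0 := by linarith
  have m1 : f + s • h ∈ L.minimizers E z lam H :=
    mem_minimizers_of_norm_op_le hlam hf.1 (hH s) (by linarith [hle s hr1])
  have m2 : f + (-s) • h ∈ L.minimizers E z lam H :=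
    mem_minimizers_of_norm_op_le hlam hf.1 (hH (-s)) (by linarith [hle (-s) hr2])
  have hseg : f ∈ openSegment ℝ (f + s • h) (f + (-s) • h) :=
    ⟨1 / 2, 1 / 2, by norm_num, by norm_num, by norm_num, by module⟩
  have h4 : f + s • h = f := hf.2 m1 m2 hseg
  exact (smul_eq_zero.mp (left_eq_add.mp h4.symm)).resolve_left hs.ne'

theorem op_sum_apply [IsFiniteMeasure μ] {K : ℕ} {h : Fin K → L.searchSpace} {χ : Fin K → C₀(ℝ, ℝ)}
    (hh : ∀ k (g : C₀(ℝ, ℝ)), L.op (h k) g = ∫ y, η y * χ k y * g y ∂μ) (t : Fin K → ℝ)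
    (g : C₀(ℝ, ℝ)) :
    L.op (∑ k, t k • h k) g = ∫ y, η y * (∑ k, t k • χ k : C₀(ℝ, ℝ)) y * g y ∂μ := by
  rw [map_sum, _root_.sum_apply]
  simp only [sum_smul_apply, Finset.mul_sum, Finset.sum_mul]
  rw [integral_finsetSum]
  · refine Finset.sum_congr rfl fun k _ => ?_
    rw [map_smul, _root_.smul_apply, hh, smul_eq_mul, ← integral_const_mul]
    refine integral_congr_ae (Eventually.of_forall fun y => ?_)
    change t k * (η y * χ k y * g y) = η y * (t k * χ k y) * g y
    ring
  · intro k _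
    exact integrable_zeroAtInfty μ (η * (t k • χ k) * g)

/-- The support of the polar measure of an extreme minimizer has at most `M - N₀` points. -/
theorem card_support_le (hρ : L.IsGreen ρ) (p : Module.Basis (Fin N₀) ℝ L.nullSpace)
    (hfeas : ∃ f, E z (H f) ≠ ⊤) (hlam : 0 < lam) {f : L.searchSpace}
    (hf : f ∈ (L.minimizers E z lam H).extremePoints ℝ) (hpol : IsPolar (L.op f) η μ)
    {K : ℕ} {x : Fin K → ℝ} (hx : Function.Injective x) (hsupp : ∀ k, x k ∈ μ.support) :
    K + N₀ ≤ M := by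
  have := hpol.isFinite
  obtain ⟨S, hS⟩ := hpol.bounded
  obtain ⟨χ, hχ1, hχ⟩ := exists_interpolation hx
  have hex : ∀ k, ∃ h : L.searchSpace, ∀ g : C₀(ℝ, ℝ), L.op h g = ∫ y, η y * χ k y * g y ∂μ := by
    intro k
    obtain ⟨h, hh⟩ := hρ.exists_op_eq_weighted (μ := μ) (θ := fun y => η y * χ k y)
      (η.continuous.mul (χ k).continuous).measurable (fun y => by
        rw [abs_mul]
        exact mul_le_one₀ (hpol.abs_apply_le_one y) (abs_nonneg _) (hχ1 k y)) hS
    exact ⟨h, fun g => by rw [hh, weighted_apply]⟩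
  choose h hh using hex
  -- The admissible directions: preimages under `L` of `η χ_k μ`, together with the null space.
  let T : ((Fin K → ℝ) × (Fin N₀ → ℝ)) →ₗ[ℝ] L.searchSpace :=
    (Fintype.linearCombination ℝ h).coprod
      (Fintype.linearCombination ℝ fun n => (p n : L.searchSpace))
  have hT : ∀ t c, T (t, c) = ∑ k, t k • h k + ∑ n, c n • (p n : L.searchSpace) :=
    fun t c => rfl
  have hopT : ∀ t c (g : C₀(ℝ, ℝ)), L.op (T (t, c)) g =
      ∫ y, η y * (∑ k, t k • χ k : C₀(ℝ, ℝ)) y * g y ∂μ := by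
    intro t c g
    rw [hT, map_add, op_sum_basis, add_zero]
    exact op_sum_apply hh t g
  have hinj : Function.Injective (H ∘ₗ T) := by
    rw [injective_iff_map_eq_zero]
    rintro ⟨t, c⟩ hHT
    have hT0 : T (t, c) = 0 :=
      eq_zero_of_mem_extremePoints hfeas hlam hf hpol hHT (hopT t c)
    let τ : C₀(ℝ, ℝ) := ∑ k, t k • χ k
    -- Test `L (T (t, c)) = 0` against `η τ` and use `η² = 1` almost everywhere.
    have hsq : ∫ y, τ y * τ y ∂μ = 0 := by
      have h0 := hopT t c (η * τ)
      rw [hT0, map_zero, _root_.zero_apply] at h0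
      rw [h0]
      refine integral_congr_ae (hpol.abs_eq_one.mono fun y hy => ?_)
      change τ y * τ y = η y * τ y * (η y * τ y)
      have h1 : η y * η y = 1 := by rw [← abs_mul_abs_self, hy, one_mul]
      linear_combination (-(τ y * τ y)) * h1
    have ht : t = 0 := by
      ext j
      have h1 := eqOn_support_of_integral_sq_eq_zero hsq (hsupp j)
      rw [sum_smul_apply] at h1
      simpa [hχ] using h1
    have hc : c = 0 := by
      refine eq_zero_of_sum_basis_eq_zero p (Eq.trans ?_ hT0)
      rw [hT, ht]
      simp only [Pi.zero_apply, zero_smul, Finset.sum_const_zero, zero_add]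
    rw [ht, hc]
    rfl
  have := LinearMap.finrank_le_finrank_of_injective hinj
  simpa using this

end LSIOperator

/-! ### Spline form of extreme minimizers -/

namespace LSIOperator

variable {L : LSIOperator} {M N₀ : ℕ} {ρ : Fn} {p : Module.Basis (Fin N₀) ℝ L.nullSpace}
  {φ : Fin N₀ → L.searchSpace →ₗ[ℝ] ℝ} {H : L.searchSpace →ₗ[ℝ] (Fin M → ℝ)}
  {E : (Fin M → ℝ) → (Fin M → ℝ) → ℝ≥0∞} {z : Fin M → ℝ} {lam : ℝ}
  {η : C₀(ℝ, ℝ)} {μ : Measure ℝ}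

/-- Finite enumeration of the support of the polar measure of an extreme minimizer. -/
theorem exists_enum_support (hρ : L.IsGreen ρ) (p : Module.Basis (Fin N₀) ℝ L.nullSpace)
    (hfeas : ∃ f, E z (H f) ≠ ⊤) (hlam : 0 < lam) {f : L.searchSpace}
    (hf : f ∈ (L.minimizers E z lam H).extremePoints ℝ) (hpol : IsPolar (L.op f) η μ) :
    ∃ (K : ℕ) (x : Fin K → ℝ), K + N₀ ≤ M ∧ Function.Injective x ∧ range x = μ.support := by
  have hcard : ∀ T : Finset ℝ, (T : Set ℝ) ⊆ μ.support → T.card + N₀ ≤ M := fun T hT =>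
    card_support_le hρ p hfeas hlam hf hpol
      (Subtype.val_injective.comp T.equivFin.symm.injective)
      (fun k => hT (T.equivFin.symm k).2)
  have hfin : μ.support.Finite := by
    by_contra hinf
    obtain ⟨T, hT, hTc⟩ := Set.Infinite.exists_subset_card_eq hinf (M + 1)
    have := hcard T hT
    omega
  refine ⟨hfin.toFinset.card, fun k => (hfin.toFinset.equivFin.symm k : ℝ),
    hcard _ (by simp), Subtype.val_injective.comp (Equiv.injective _), ?_⟩
  ext y
  constructor
  · rintro ⟨k, rfl⟩
    exact hfin.mem_toFinset.mp (hfin.toFinset.equivFin.symm k).2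
  · intro hy
    exact ⟨hfin.toFinset.equivFin ⟨y, hfin.mem_toFinset.mpr hy⟩, by simp⟩

/-- Subtracting `∑ a_k ρ(· - x_k)`, which has the same image under `L`, leaves an element of the
null space. -/
theorem IsGreen.exists_eq_sum_shift (hρ : L.IsGreen ρ) (p : Module.Basis (Fin N₀) ℝ L.nullSpace)
    {f : L.searchSpace} {K : ℕ} {x a : Fin K → ℝ} (h : L.op f = ∑ k, a k • dirac (x k)) :
    ∃ b : Fin N₀ → ℝ, (f : Fn) =
      ∑ k, a k • shift (x k) ρ + ∑ n, b n • ((p n : L.searchSpace) : Fn) := by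
  let s : L.searchSpace := ∑ k, a k • ⟨shift (x k) ρ, hρ.shift_mem (x k)⟩
  have hs : L.op s = L.op f := by
    rw [h, map_sum]
    exact Finset.sum_congr rfl fun k _ => by rw [map_smul, hρ.op_shift]
  obtain ⟨b, hb⟩ := exists_eq_sum_basis p (f := f - s) (by rw [map_sub, hs, sub_self])
  refine ⟨b, ?_⟩
  rw [sub_eq_iff_eq_add'] at hb
  have h1 := congrArg L.searchSpace.subtype hb
  rw [map_add, map_sum, map_sum] at h1
  exact h1

theorem exists_spline_of_mem_extremePoints (hρ : L.IsGreen ρ)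
    (p : Module.Basis (Fin N₀) ℝ L.nullSpace) (hfeas : ∃ f, E z (H f) ≠ ⊤) (hlam : 0 < lam)
    {f : L.searchSpace} (hf : f ∈ (L.minimizers E z lam H).extremePoints ℝ)
    (hpol : IsPolar (L.op f) η μ) :
    ∃ (K : ℕ) (x a : Fin K → ℝ) (b : Fin N₀ → ℝ), K + N₀ ≤ M ∧ L.IsSpline f x a ∧
      (f : Fn) = ∑ k, a k • shift (x k) ρ + ∑ n, b n • ((p n : L.searchSpace) : Fn) ∧
      ‖L.op f‖ = ∑ k, |a k| := by
  obtain ⟨K, x, hK, hx, hrange⟩ := exists_enum_support hρ p hfeas hlam hf hpol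
  obtain ⟨a, ha, hnorm⟩ := hpol.eq_sum_dirac hx (hrange ▸ Measure.support_mem_ae)
  obtain ⟨b, hb⟩ := hρ.exists_eq_sum_shift p ha
  exact ⟨K, x, a, b, hK, ⟨hx, ha⟩, hb, hnorm⟩

end LSIOperator

end GTV

end

/-! ### The representer theorem -/

theorem theorem2 {M N₀ : ℕ} (L : GTV.LSIOperator) (hL : L.SplineAdmissible)
    (ρ : GTV.Fn) (hρ : L.IsGreen ρ)
    (p : Module.Basis (Fin N₀) ℝ L.nullSpace)
    (φ : Fin N₀ → L.searchSpace →ₗ[ℝ] ℝ) (hφ : L.Biorthonormal p φ)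
    (H : L.searchSpace →ₗ[ℝ] (Fin M → ℝ))
    (hH : Continuous[L.weakStar φ, inferInstance] H)
    (hwell : ∀ q₁ ∈ L.nullSpace, ∀ q₂ ∈ L.nullSpace, H q₁ = H q₂ ↔ q₁ = q₂)
    (E : (Fin M → ℝ) → (Fin M → ℝ) → ℝ≥0∞) (z : Fin M → ℝ)
    (hconv : ConvexOn ℝ≥0 univ (E z))
    (hlsc : LowerSemicontinuous (E z))
    (hcoer : Tendsto (E z) (cocompact (Fin M → ℝ)) (𝓝 ⊤))
    (hfeas : ∃ f, E z (H f) ≠ ⊤)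
    (lam : ℝ) (hlam : 0 < lam) :
    (L.minimizers E z lam H).Nonempty ∧
    Convex ℝ (L.minimizers E z lam H) ∧
    @IsCompact _ (L.weakStar φ) (L.minimizers E z lam H) ∧
    closure[L.weakStar φ] (convexHull ℝ ((L.minimizers E z lam H).extremePoints ℝ)) =
      L.minimizers E z lam H ∧
    ∀ f ∈ (L.minimizers E z lam H).extremePoints ℝ,
      ∃ (K : ℕ) (x a : Fin K → ℝ) (b : Fin N₀ → ℝ),
        K + N₀ ≤ M ∧
        L.IsSpline f x a ∧
        (f : GTV.Fn) = ∑ k, a k • GTV.shift (x k) ρ + ∑ n, b n • ((p n : L.searchSpace) : GTV.Fn) ∧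
        ‖L.op f‖ = ∑ k, |a k| := by
  obtain ⟨A, ψ, hAH, hψ⟩ := GTV.LSIOperator.exists_factor hH
  have hA : ∀ c, A (0, c) = 0 → c = 0 := by
    intro c hc
    rw [← hφ.embed_sum c, hAH] at hc
    refine GTV.eq_zero_of_sum_basis_eq_zero p ?_
    exact (hwell _ (GTV.LSIOperator.op_sum_basis c) 0 (zero_mem _)).mp (by rw [hc, map_zero])
  have hfeas' : ∃ y, E z (A y) ≠ ⊤ := by
    obtain ⟨f, hf⟩ := hfeas
    exact ⟨GTV.LSIOperator.embed φ f, by rwa [hAH]⟩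
  have hpol : ∀ y ∈ GTV.dualMinimizers (E z) lam A,
      ∃ η μ, GTV.IsPolar (WeakDual.toStrongDual y.1) η μ := by
    intro y hy
    obtain ⟨η, hη, hw⟩ := GTV.exists_certificate hlam hfeas' ψ hψ hy
    obtain ⟨μ, h1, h2, h3, h4, h5⟩ := GTV.exists_measure_of_norm_attained
      (w := WeakDual.toStrongDual y.1) hη hw
    exact ⟨η, μ, h1, hη, h2, h3, h4, h5⟩
  -- Optimality forces compact support, which supplies the preimage under `L`.
  have hrange : GTV.dualMinimizers (E z) lam A ⊆ range (GTV.LSIOperator.embed φ) := by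
    intro y hy
    obtain ⟨η, μ, h⟩ := hpol y hy
    obtain ⟨f, hf⟩ := hρ.exists_op_eq h
    have h1 := hφ.mem_range_embed f y.2
    rw [hf] at h1
    exact h1
  have hcost := GTV.LSIOperator.cost_eq_dualCost (E := E) (z := z) (lam := lam) hAH
  obtain ⟨y₀, hy₀⟩ := GTV.dualMinimizers_nonempty hlam hlsc hcoer hA hfeas'
  obtain ⟨f₀, hf₀⟩ := hrange hy₀
  -- Since the relaxed minimizer `y₀` comes from `f₀ ∈ 𝓧₁`, the relaxation does not lower the
  -- minimum.
  have hmin : L.minimizers E z lam H =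
      GTV.LSIOperator.embed φ ⁻¹' GTV.dualMinimizers (E z) lam A := by
    ext f
    refine ⟨fun hf y => ?_, fun hf g => ?_⟩
    · rw [← hcost]
      refine (hf f₀).trans ?_
      rw [hcost, hf₀]
      exact hy₀ y
    · rw [hcost, hcost]
      exact hf _
  have hcvx : Convex ℝ (L.minimizers E z lam H) := GTV.LSIOperator.convex_minimizers hconv hlam
  have hcomp : @IsCompact _ (TopologicalSpace.induced (GTV.LSIOperator.embed φ) inferInstance)
      (L.minimizers E z lam H) := by
    let _ : TopologicalSpace L.searchSpace :=
      TopologicalSpace.induced (GTV.LSIOperator.embed φ) inferInstance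
    have hind : IsInducing (GTV.LSIOperator.embed φ) := ⟨rfl⟩
    rw [hind.isCompact_iff, hmin, image_preimage_eq_of_subset hrange]
    exact GTV.isCompact_dualMinimizers hlam hlsc hcoer hA hfeas'
  refine ⟨⟨f₀, ?_⟩, hcvx, ?_, ?_, fun f hf => ?_⟩
  · rw [hmin, mem_preimage, hf₀]
    exact hy₀
  · rw [GTV.LSIOperator.weakStar_eq_induced]
    exact hcomp
  · rw [GTV.LSIOperator.weakStar_eq_induced]
    exact GTV.closure_convexHull_extremePoints_induced_weakDual (GTV.LSIOperator.embed φ)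
      hφ.embed_injective hcomp hcvx
  · have hf' : f ∈ GTV.LSIOperator.embed φ ⁻¹' GTV.dualMinimizers (E z) lam A := hmin ▸ hf.1
    obtain ⟨η, μ, h⟩ := hpol _ hf'
    exact GTV.LSIOperator.exists_spline_of_mem_extremePoints hρ p hfeas hlam hf h
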